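/- Let $r\ge s\ge 1$ be integers. All posets below are subsets of $\mathbb N\times\mathbb N$ with the product order: $RT_{r,s}=\{(i,j): 1\le i\le r+s-1,\ 1\le j\le s,\ i-j<r\}$, $T_{r,s}=\{(i,j)\in RT_{r,s}: i+j>s\}$, and for $1\le k\le s$ the intermediate poset $$I_k=T_{r,k}\cup\{(i,j)\in RT_{r,s}: k\le i\le r+k-1,\ k+1\le j\le s\}.$$ A maximal chain of $I_k$ is *polygonal* if it contains $(k,1)$ or an element $(i,j)$ with $i-j=r-1$. The *polygonal chain polytope* $\widetilde{\mathcal C}(I_k)\subset\mathbb R^{I_k}$ is the set of $x$ with $x_p\ge 0$ for all $p\in I_k$ and $\sum_{p\in C}x_p\le 1$ for all polygonal chains $C$ of $I_k$. For a finite poset $P$ and $p\in P$, the tropical toggle $\tau_p:\mathbb R^P\to\mathbb R^P$ replaces $x_p$ by $-\max_C\sum_{q\in C}x_q$, where $C$ ranges over the maximal chains of $P$ containing $p$, and keeps the other coordinates; it is an involution. Tropical (antichain) rowmotion is $\tilde\rho=\tau_{p_n}\circ\cdots\circ\tau_{p_1}$, where $p_1,\dots,p_n$ is a linear extension of $P$.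 For $1\le k<s$ let $M_k=\{(i,j)\in RT_{r,s}: k\le i\le r+k,\ 1\le j\le k+1\}$, and define $\zeta_k:\mathbb R^{I_{k+1}}\to\mathbb R^{I_k}$ by $$\zeta_k(x)_{ij}=\begin{cases}\tilde\rho^{-1}(\bar x)_{ij}&(i,j)\in I_k\cap M_k,\\ x_{i+1,j}&(i,j)\in I_k\setminus M_k,\ j>k+1,\\ x_{i,j+1}&(i,j)\in I_k\setminus M_k,\ i<k,\end{cases}$$ where $\tilde\rho$ is rowmotion on $M_k$ and $\bar x\in\mathbb R^{M_k}$ agrees with $x$ on $M_k\setminus\{(k,1)\}$ and has an arbitrary real label $a$ at $(k,1)$. **Theorem.** (1) Let $1\le k<s$. For every choice of the linear extension of $M_k$ and of the label $a$, the map $\zeta_k$ is continuous and piecewise-linear (the domain is a finite union of polyhedra on each of which $\zeta_k$ is affine), it is lattice-preserving ($x\in\mathbb Z^{I_{k+1}}$ if and only if $\zeta_k(x)\in\mathbb Z^{I_k}$), and for every real $\ell\ge 0$ it restricts to a bijection from $\ell\cdot\widetilde{\mathcal C}(I_{k+1})$ to $\ell\cdot\widetilde{\mathcal C}(I_k)$.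 (2) Each $\widetilde{\mathcal C}(I_k)$, $1\le k\le s$, is a rational polytope (the convex hull of finitely many rational points), and for fixed $r,s$ all of them have the same Ehrhart polynomial: there is a polynomial $E\in\mathbb Q[t]$, depending only on $r$ and $s$, such that $\#\bigl(\ell\cdot\widetilde{\mathcal C}(I_k)\cap\mathbb Z^{I_k}\bigr)=E(\ell)$ for all $1\le k\le s$ and all integers $\ell\ge 0$. In particular the Ehrhart quasi-polynomial of $\widetilde{\mathcal C}(I_k)$ has least period $1$; so it exhibits period collapse (its least period is smaller than the denominator of the polytope, that is, the least $n\ge1$ such that $n\cdot\widetilde{\mathcal C}(I_k)$ is a lattice polytope) whenever $\widetilde{\mathcal C}(I_k)$ is not a lattice polytope. -/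

import Mathlib

open scoped Pointwise

noncomputable section

namespace PolygonalChain

/-! ### Tropical toggles and antichain rowmotion on a finite poset -/

section Rowmotion

variable {P : Type} [PartialOrder P] [Fintype P]

open Classical in
/-- The maximal chains of `P` that contain `p`. -/
def maxChainsThrough (p : P) : Finset (Finset P) :=
  Finset.univ.filter fun C => IsMaxChain (· ≤ ·) (C : Set P) ∧ p ∈ C

theorem maxChainsThrough_nonempty (p : P) : (maxChainsThrough p).Nonempty := by
  classical
  obtain ⟨C, hC, hp⟩ :=
    (Set.subsingleton_singleton (a := p)).isChain (r := (· ≤ ·)) |>.exists_maxChain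
  refine ⟨C.toFinset, ?_⟩
  simp only [maxChainsThrough, Finset.mem_filter, Finset.mem_univ, true_and,
    Set.coe_toFinset, Set.mem_toFinset]
  exact ⟨hC, hp (Set.mem_singleton p)⟩

open Classical in
/-- The tropical (max-plus) antichain toggle: the `p`-coordinate of `x` becomes
`-max_C ∑_{q ∈ C} x q`, with `C` ranging over the maximal chains through `p`;
all other coordinates are kept. -/
def toggleFun (p : P) (x : P → ℝ) : P → ℝ :=
  Function.update x p
    (-(maxChainsThrough p).sup' (maxChainsThrough_nonempty p) fun C => ∑ q ∈ C, x q)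

theorem toggleFun_apply_self (p : P) (x : P → ℝ) :
    toggleFun p x p = -(maxChainsThrough p).sup' (maxChainsThrough_nonempty p)
      fun C => ∑ q ∈ C, x q := by
  simp [toggleFun]

theorem toggleFun_apply_of_ne (p : P) (x : P → ℝ) {q : P} (h : q ≠ p) :
    toggleFun p x q = x q := by
  simp [toggleFun, h]

theorem toggleFun_involutive (p : P) : Function.Involutive (toggleFun p) := by
  classical
  intro x
  have key : ∀ y : P → ℝ, (∀ q, q ≠ p → y q = x q) →
      (maxChainsThrough p).sup' (maxChainsThrough_nonempty p) (fun C => ∑ q ∈ C, y q)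
        = y p + (maxChainsThrough p).sup' (maxChainsThrough_nonempty p)
            (fun C => ∑ q ∈ C.erase p, x q) := by
    intro y hy
    rw [Finset.apply_sup'_eq_sup'_comp (maxChainsThrough_nonempty p) (fun t : ℝ => y p + t)
      (fun a b => by exact (max_add_add_left (y p) a b).symm)]
    refine Finset.sup'_congr _ rfl fun C hC => ?_
    have hp : p ∈ C := by
      simp only [maxChainsThrough, Finset.mem_filter] at hC
      exact hC.2.2
    rw [← Finset.add_sum_erase C y hp]
    simp only [Function.comp]
    congr 1
    exact Finset.sum_congr rfl fun q hq => hy q (Finset.ne_of_mem_erase hq)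
  funext q
  by_cases h : q = p
  · subst h
    rw [toggleFun_apply_self, key _ fun q' hq' => toggleFun_apply_of_ne q x hq',
      toggleFun_apply_self, key x fun _ _ => rfl]
    ring
  · rw [toggleFun_apply_of_ne _ _ h, toggleFun_apply_of_ne _ _ h]

/-- The tropical antichain toggle at `p`, as a bijection of `ℝ^P` (it is an involution). -/
def toggle (p : P) : Equiv.Perm (P → ℝ) :=
  (toggleFun_involutive p).toPerm

end Rowmotion

/-- A linear extension of `P`: an order-preserving bijection `P → {0, …, |P| - 1}`. -/
structure LinExt (P : Type) [PartialOrder P] [Fintype P] where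
  toEquiv : P ≃ Fin (Fintype.card P)
  monotone : Monotone toEquiv

/-- Every finite poset has a linear extension. -/
theorem LinExt.nonempty (P : Type) [PartialOrder P] [Fintype P] : Nonempty (LinExt P) := by
  classical
  let _ : Fintype (LinearExtension P) := ‹Fintype P›
  let e : Fin (Fintype.card P) ≃o LinearExtension P :=
    Fintype.orderIsoFinOfCardEq (LinearExtension P) rfl
  refine ⟨⟨e.symm.toEquiv, fun a b h => ?_⟩⟩
  exact e.symm.monotone ((toLinearExtension (α := P)).monotone' h)

/-- Tropical antichain rowmotion: the toggles composed along a linear extension, from bottom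
to top, `τ_{L⁻¹(n)} ∘ ⋯ ∘ τ_{L⁻¹(2)} ∘ τ_{L⁻¹(1)}`. -/
def rowmotion {P : Type} [PartialOrder P] [Fintype P] (L : LinExt P) : Equiv.Perm (P → ℝ) :=
  (List.ofFn fun i => toggle (L.toEquiv.symm i)).reverse.prod

/-! ### The posets

All posets are finite subsets of `ℕ × ℕ` with the product order. -/

/-- The right trapezoid `{(i, j) | i - j < r}` inside `[r + s - 1] × [s]`. -/
def RT (r s : ℕ) : Finset (ℕ × ℕ) :=
  (Finset.Icc 1 (r + s - 1) ×ˢ Finset.Icc 1 s).filter fun p => p.1 < r + p.2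

/-- The trapezoid `{(i, j) | i + j > s}` inside the right trapezoid. -/
def T (r s : ℕ) : Finset (ℕ × ℕ) :=
  (RT r s).filter fun p => s < p.1 + p.2

/-- The intermediate poset `I_k`: the trapezoid `T r k` together with the interval
`[(k, k + 1), (r + k - 1, s)]` of `RT r s`. -/
def I (r s k : ℕ) : Finset (ℕ × ℕ) :=
  (RT r s).filter fun p => p ∈ T r k ∨ ((k, k + 1) ≤ p ∧ p ≤ (r + k - 1, s))

/-- The interval `M_k = [(k, 1), (r + k, k + 1)]` of `RT r s`. -/
def M (r s k : ℕ) : Finset (ℕ × ℕ) :=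
  (RT r s).filter fun p => (k, 1) ≤ p ∧ p ≤ (r + k, k + 1)

theorem mem_I_succ_of_mem_M {r s k : ℕ} {p : ℕ × ℕ} (hp : p ∈ M r s k) (h : p ≠ (k, 1)) :
    p ∈ I r s (k + 1) := by
  obtain ⟨i, j⟩ := p
  simp only [M, I, T, RT, Finset.mem_filter, Finset.mem_product, Finset.mem_Icc,
    Prod.mk_le_mk, ne_eq, Prod.mk.injEq] at *
  omega

theorem mem_I_succ_of_above {r s k : ℕ} (hk : k < s) {i j : ℕ} (hp : (i, j) ∈ I r s k)
    (h : k + 1 < j) : (i + 1, j) ∈ I r s (k + 1) := by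
  simp only [I, T, RT, Finset.mem_filter, Finset.mem_product, Finset.mem_Icc,
    Prod.mk_le_mk] at *
  omega

theorem mem_I_succ_of_below {r s k : ℕ} (hk : k < s) {i j : ℕ} (hp : (i, j) ∈ I r s k)
    (hM : (i, j) ∉ M r s k) (h : ¬ k + 1 < j) : (i, j + 1) ∈ I r s (k + 1) := by
  simp only [M, I, T, RT, Finset.mem_filter, Finset.mem_product, Finset.mem_Icc,
    Prod.mk_le_mk] at *
  omega

/-- An element of `I_k` outside `M_k` with `j ≤ k + 1` has `i < k`, so the case distinction in
`zeta` is the one between labels above `M_k` and labels below `M_k`. -/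
theorem below_iff {r s k : ℕ} {i j : ℕ} (hp : (i, j) ∈ I r s k) (hM : (i, j) ∉ M r s k) :
    ¬ k + 1 < j ↔ i < k := by
  simp only [M, I, T, RT, Finset.mem_filter, Finset.mem_product, Finset.mem_Icc,
    Prod.mk_le_mk] at *
  omega

/-! ### The tropical map `ζ_k` -/

/-- The labeling of `M_k` which agrees with `x` off the minimum `(k, 1)` and is `a` there. -/
def extendLabel {r s k : ℕ} (a : ℝ) (x : I r s (k + 1) → ℝ) : M r s k → ℝ := fun p =>
  if h : p.1 = (k, 1) then a else x ⟨p.1, mem_I_succ_of_mem_M p.2 h⟩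

/-- The tropical map `ζ_k : ℝ^{I_{k+1}} → ℝ^{I_k}`: inverse antichain rowmotion inside `M_k`
(computed with a linear extension `L` of `M_k` and an arbitrary label `a` at `(k, 1)`);
outside `M_k`, labels above `M_k` are shifted southeast, labels below it southwest. -/
def zeta {r s k : ℕ} (hk : k < s) (L : LinExt (M r s k)) (a : ℝ)
    (x : I r s (k + 1) → ℝ) : I r s k → ℝ := fun p =>
  if hM : p.1 ∈ M r s k then (rowmotion L).symm (extendLabel a x) ⟨p.1, hM⟩
  else if h : k + 1 < p.1.2 then x ⟨(p.1.1 + 1, p.1.2), mem_I_succ_of_above hk p.2 h⟩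
  else x ⟨(p.1.1, p.1.2 + 1), mem_I_succ_of_below hk p.2 hM h⟩

/-! ### Polygonal chains and their polytope -/

/-- A maximal chain of `I_k` is polygonal if it meets the left border
`{(i, j) | i = j + r - 1}` of the right trapezoid or contains `(k, 1)`. -/
def IsPolygonal {r s k : ℕ} (C : Finset (I r s k)) : Prop :=
  IsMaxChain (· ≤ ·) (C : Set (I r s k)) ∧
    ((∃ p ∈ C, p.1.1 + 1 = p.1.2 + r) ∨ ∃ p ∈ C, p.1 = (k, 1))

/-- The polygonal chain polytope of `I_k`. -/
def chainPolytope (r s k : ℕ) : Set (I r s k → ℝ) :=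
  {x | (∀ p, 0 ≤ x p) ∧ ∀ C : Finset (I r s k), IsPolygonal C → ∑ p ∈ C, x p ≤ 1}

/-! ### Piecewise-linear maps, polytopes and Ehrhart theory -/

/-- A finite intersection of closed half-spaces. -/
def IsPolyhedron {ι : Type} (Q : Set (ι → ℝ)) : Prop :=
  ∃ H : Set (((ι → ℝ) →ₗ[ℝ] ℝ) × ℝ), H.Finite ∧ Q = {x | ∀ h ∈ H, h.1 x ≤ h.2}

/-- The domain is a finite union of polyhedra on each of which `f` is affine. -/
def IsPiecewiseLinear {ι κ : Type} (f : (ι → ℝ) → (κ → ℝ)) : Prop :=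
  ∃ 𝒬 : Set (Set (ι → ℝ)), 𝒬.Finite ∧ ⋃₀ 𝒬 = Set.univ ∧
    ∀ Q ∈ 𝒬, IsPolyhedron Q ∧ ∃ A : (ι → ℝ) →ᵃ[ℝ] (κ → ℝ), Set.EqOn f A Q

/-- The lattice `ℤ^ι` inside `ℝ^ι`. -/
def lattice (ι : Type) : Set (ι → ℝ) := {x | ∀ i, ∃ n : ℤ, x i = n}

/-- The convex hull of finitely many rational points. -/
def IsRationalPolytope {ι : Type} (Q : Set (ι → ℝ)) : Prop :=
  ∃ V : Set (ι → ℝ), V.Finite ∧ (∀ v ∈ V, ∀ i, ∃ t : ℚ, v i = t) ∧ Q = convexHull ℝ V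

/-- The convex hull of finitely many lattice points. -/
def IsLatticePolytope {ι : Type} (Q : Set (ι → ℝ)) : Prop :=
  ∃ V : Set (ι → ℝ), V.Finite ∧ V ⊆ lattice ι ∧ Q = convexHull ℝ V

/-- The denominator of a rational polytope: the least `n ≥ 1` such that its `n`-th dilate
is a lattice polytope. -/
def denominator {ι : Type} (Q : Set (ι → ℝ)) : ℕ :=
  sInf {n : ℕ | 0 < n ∧ IsLatticePolytope ((n : ℝ) • Q)}

/-- The Ehrhart counting function: the number of lattice points in the `ℓ`-th dilate. -/
def ehrhartCount {ι : Type} (Q : Set (ι → ℝ)) (ℓ : ℕ) : ℕ :=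
  (((ℓ : ℝ) • Q) ∩ lattice ι).ncard

/-- The Ehrhart counting function is a quasi-polynomial with (not necessarily least)
period `n`. -/
def IsEhrhartPeriod {ι : Type} (Q : Set (ι → ℝ)) (n : ℕ) : Prop :=
  0 < n ∧ ∃ q : ℕ → Polynomial ℚ, ∀ ℓ : ℕ, (ehrhartCount Q ℓ : ℚ) = (q (ℓ % n)).eval (ℓ : ℚ)

/-- The least period of the Ehrhart quasi-polynomial. -/
def ehrhartPeriod {ι : Type} (Q : Set (ι → ℝ)) : ℕ := sInf {n : ℕ | IsEhrhartPeriod Q n}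

/-- Period collapse: the least period of the Ehrhart quasi-polynomial of the rational polytope
`Q` is smaller than the denominator of `Q`. -/
def HasPeriodCollapse {ι : Type} (Q : Set (ι → ℝ)) : Prop :=
  IsRationalPolytope Q ∧ ehrhartPeriod Q < denominator Q

end PolygonalChain

end

noncomputable section

namespace PolygonalChain

/-! ### Chains in finite posets -/

section Chains

variable {P : Type} [PartialOrder P]

/-! Everything passes through potentials. For a labeling x of a finite poset let F p be the largest
sum of x over the maximal chains of the ideal below p; then x p is F p minus the maximum of F over
the elements covered by p. Read from above, the same F gives y p, the minimum of F over the covers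
of p, minus F p, with y p = -F p at maximal elements. Toggling from top to bottom turns x into y one
coordinate at a time, so inverse rowmotion keeps F and changes the reading (`rowmotion_symm_eq`).
Hence x, F and y are integral together. Changing the label a only adds a constant to F, which alters
y only at the maximum (r+k, k+1) of M_k, a point outside I_k. This gives independence of the label
and, after normalizing the value at that point, bijectivity of ζ_k.

Outside M_k the potential is extended by partial sums, so that the shifts in ζ_k are differences of
F as well. In this form (`ShiftData`), nonnegativity of either labeling makes F nondecreasing along
the relevant unit steps, which makes the other labeling nonnegative.

The heart is the comparison of polygonal chains. Give a chain of weight w ending at p the reduced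
weight w - F p. A unit step never raises it, and keeps it when the step attains the maximum defining
x. So the end of a chain can be moved to a neighbour at no cost, by rerouting along maximizing steps
until the old chain is met (`FreePrefix.shift`, `PolyPrefix.shift`). The rerouting respects what
makes a chain polygonal. Walking up a polygonal chain of I_k, one carries an initial chain of
I_{k+1} ending one step above or to the right; at the maximum the weights match
(`ShiftData.sum_le`). The order-dual argument with suffixes gives the converse bound
(`ShiftData.sum_le'`).

Thus all k have the Ehrhart counts of k = 1. There every maximal chain contains (1, 1), so the
polytope is Stanley's chain polytope, and x ↦ F matches lattice points of its dilates with bounded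
monotone integer functions, counted by the order polynomial. Rationality holds because an extreme
point is determined by its tight constraints, which have rational data. -/

theorem mem_of_forall_comparable {C : Set P} (hC : IsMaxChain (· ≤ ·) C) {z : P}
    (h : ∀ c ∈ C, c ≤ z ∨ z ≤ c) : z ∈ C := by
  have h1 : IsChain (· ≤ ·) (insert z C) := hC.1.insert fun b hb _ => (h b hb).symm
  have h2 := hC.2 h1 (Set.subset_insert z C)
  rw [h2]
  exact Set.mem_insert z C

theorem isMaxChain_of_forall_comparable {C : Set P} (hC : IsChain (· ≤ ·) C)
    (h : ∀ z, (∀ c ∈ C, c ≤ z ∨ z ≤ c) → z ∈ C) : IsMaxChain (· ≤ ·) C := by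
  refine ⟨hC, fun t ht hCt => Set.Subset.antisymm hCt fun z hz => h z fun c hc => ?_⟩
  exact ht.total (hCt hc) hz

/-- Maximal chains are saturated: an element strictly between p and the largest chain element below
p would be comparable to the whole chain, hence belong to it. -/
theorem exists_covBy_mem {C : Finset P} (hC : IsMaxChain (· ≤ ·) (C : Set P)) {p : P}
    (hp : p ∈ C) (hmin : ¬ IsMin p) : ∃ q ∈ C, q ⋖ p := by
  classical
  have hne : (C.filter (· < p)).Nonempty := by
    by_contra hemp
    rw [Finset.not_nonempty_iff_eq_empty, Finset.filter_eq_empty_iff] at hemp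
    obtain ⟨z, hz⟩ := not_isMin_iff.1 hmin
    have hzC : z ∈ (C : Set P) := mem_of_forall_comparable hC fun c hc => by
      rcases hC.1.total hc hp with h | h
      · rcases h.lt_or_eq with h | h
        · exact absurd h (hemp hc)
        · exact Or.inr (h ▸ hz.le)
      · exact Or.inr (hz.le.trans h)
    exact hemp hzC hz
  obtain ⟨q, hq⟩ := Finset.exists_maximal hne
  have hqm := Finset.mem_filter.1 hq.prop
  refine ⟨q, hqm.1, hqm.2, fun z hqz hzp => ?_⟩
  have hzC : z ∈ (C : Set P) := mem_of_forall_comparable hC fun c hc => by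
    rcases hC.1.total hc hp with h | h
    · rcases h.lt_or_eq with h | h
      · rcases hC.1.total hc hqm.1 with h' | h'
        · exact Or.inl (h'.trans hqz.le)
        · exact Or.inl ((hq.le_of_ge (Finset.mem_filter.2 ⟨hc, h⟩) h').trans hqz.le)
      · exact Or.inr (h ▸ hzp.le)
    · exact Or.inr (hzp.le.trans h)
  exact (hq.le_of_ge (Finset.mem_filter.2 ⟨hzC, hzp⟩) hqz.le).not_gt hqz

theorem exists_covBy_mem_of_not_isMax {C : Finset P} (hC : IsMaxChain (· ≤ ·) (C : Set P)) {p : P}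
    (hp : p ∈ C) (hmax : ¬ IsMax p) : ∃ q ∈ C, p ⋖ q := by
  have hC' : IsMaxChain (α := Pᵒᵈ) (· ≤ ·) (C : Set P) := hC.symm
  obtain ⟨q, hq, hqp⟩ := exists_covBy_mem (P := Pᵒᵈ) (C := C) hC' (p := p) hp hmax
  exact ⟨q, hq, hqp.ofDual⟩

open Classical in
theorem sum_filter_lt_of_isMin {C : Finset P} {p : P} (hp : IsMin p) (f : P → ℝ) :
    ∑ q ∈ C with q < p, f q = 0 := by
  rw [Finset.filter_false_of_mem fun q _ => hp.not_lt, Finset.sum_empty]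

open Classical in
theorem sum_filter_gt_of_isMax {C : Finset P} {p : P} (hp : IsMax p) (f : P → ℝ) :
    ∑ q ∈ C with p < q, f q = 0 := by
  rw [Finset.filter_false_of_mem fun q _ => hp.not_lt, Finset.sum_empty]

open Classical in
theorem sum_filter_lt_of_covBy {C : Finset P} (hC : IsChain (· ≤ ·) (C : Set P)) {q p : P}
    (hq : q ∈ C) (hqp : q ⋖ p) (f : P → ℝ) :
    ∑ z ∈ C with z < p, f z = (∑ z ∈ C with z < q, f z) + f q := by
  have : C.filter (· < p) = insert q (C.filter (· < q)) := by
    ext z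
    simp only [Finset.mem_filter, Finset.mem_insert]
    constructor
    · rintro ⟨hz, hzp⟩
      rcases hC.total hz hq with h | h
      · rcases h.lt_or_eq with h | h
        · exact Or.inr ⟨hz, h⟩
        · exact Or.inl h
      · rcases h.lt_or_eq with h | h
        · exact absurd hzp (hqp.2 h)
        · exact Or.inl h.symm
    · rintro (rfl | ⟨hz, hzq⟩)
      · exact ⟨hq, hqp.1⟩
      · exact ⟨hz, hzq.trans hqp.1⟩
  rw [this, Finset.sum_insert (by simp), add_comm]

open Classical in
theorem sum_filter_gt_of_covBy {C : Finset P} (hC : IsChain (· ≤ ·) (C : Set P)) {q p : P}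
    (hq : q ∈ C) (hpq : p ⋖ q) (f : P → ℝ) :
    ∑ z ∈ C with p < z, f z = (∑ z ∈ C with q < z, f z) + f q :=
  sum_filter_lt_of_covBy (P := Pᵒᵈ) (C := C) (q := q) (p := p) hC.symm hq hpq.toDual f

open Classical in
theorem sum_eq_sum_lt_add_sum_gt {C : Finset P} (hC : IsChain (· ≤ ·) (C : Set P)) {p : P}
    (hp : p ∈ C) (f : P → ℝ) :
    ∑ z ∈ C, f z = (∑ z ∈ C with z < p, f z) + f p + ∑ z ∈ C with p < z, f z := by
  have : C = insert p (C.filter (· < p) ∪ C.filter (p < ·)) := by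
    ext z
    simp only [Finset.mem_filter, Finset.mem_insert, Finset.mem_union]
    constructor
    · intro hz
      rcases hC.total hz hp with h | h
      · rcases h.lt_or_eq with h | h
        · exact Or.inr (Or.inl ⟨hz, h⟩)
        · exact Or.inl h
      · rcases h.lt_or_eq with h | h
        · exact Or.inr (Or.inr ⟨hz, h⟩)
        · exact Or.inl h.symm
    · rintro (rfl | ⟨hz, -⟩ | ⟨hz, -⟩) <;> assumption
  conv_lhs => rw [this]
  rw [Finset.sum_insert (by simp), Finset.sum_union]
  · ring
  · rw [Finset.disjoint_filter]
    exact fun z _ h1 h2 => lt_asymm h1 h2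

/-- `C` is a maximal chain of the principal ideal of `p`, containing `p`. -/
structure IsLowerChain (p : P) (C : Finset P) : Prop where
  chain : IsChain (· ≤ ·) (C : Set P)
  mem : p ∈ C
  le : ∀ q ∈ C, q ≤ p
  maximal : ∀ z ≤ p, (∀ q ∈ C, q ≤ z ∨ z ≤ q) → z ∈ C

theorem IsLowerChain.singleton {p : P} (hp : IsMin p) : IsLowerChain p {p} where
  chain := by simp
  mem := by simp
  le := by simp
  maximal := fun z hz _ => by simp [hp.eq_of_le hz]

theorem IsLowerChain.insert_of_covBy [DecidableEq P] {q p : P} {C : Finset P} (hC : IsLowerChain q C) (hqp : q ⋖ p) :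
    IsLowerChain p (insert p C) where
  chain := by
    rw [Finset.coe_insert]
    exact hC.chain.insert fun b hb _ => Or.inr ((hC.le b hb).trans hqp.1.le)
  mem := by simp
  le := by
    intro z hz
    rcases Finset.mem_insert.1 hz with rfl | hz
    · exact le_rfl
    · exact (hC.le z hz).trans hqp.1.le
  maximal := by
    intro z hzp hz
    rcases hzp.lt_or_eq with h | h
    · refine Finset.mem_insert_of_mem (hC.maximal z ?_ fun c hc => hz c (by simp [hc]))
      rcases hz q (by simp [hC.mem]) with h' | h'
      · rcases h'.lt_or_eq with h' | h'
        · exact absurd h (hqp.2 h')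
        · exact h'.ge
      · exact h'
    · simp [h]

theorem IsLowerChain.sum_insert [DecidableEq P] {q p : P} {C : Finset P} (hC : IsLowerChain q C) (hqp : q ⋖ p)
    (f : P → ℝ) : ∑ z ∈ insert p C, f z = f p + ∑ z ∈ C, f z :=
  Finset.sum_insert fun h => (hC.le p h).not_gt hqp.1

theorem IsLowerChain.isMaxChain {p : P} {C : Finset P} (hC : IsLowerChain p C)
    (hp : ∀ q, q ≤ p) : IsMaxChain (· ≤ ·) (C : Set P) :=
  isMaxChain_of_forall_comparable hC.chain fun z hz => hC.maximal z (hp z) hz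

/-- `C` is a maximal chain of the principal filter of `p`, containing `p`. -/
abbrev IsUpperChain (p : P) (C : Finset P) : Prop := IsLowerChain (P := Pᵒᵈ) p C

theorem IsLowerChain.isMaxChain_union [DecidableEq P] {p : P} {C D : Finset P} (hC : IsLowerChain p C)
    (hD : IsUpperChain p D) : IsMaxChain (· ≤ ·) ((C ∪ D : Finset P) : Set P) := by
  have hDc : IsChain (· ≤ ·) (D : Set P) := hD.chain.symm
  have hDle : ∀ q ∈ D, p ≤ q := hD.le
  have hDm : ∀ z, p ≤ z → (∀ q ∈ D, z ≤ q ∨ q ≤ z) → z ∈ D := hD.maximal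
  refine isMaxChain_of_forall_comparable ?_ fun z hz => ?_
  · rw [Finset.coe_union]
    intro a ha b hb hab
    rcases ha with ha | ha <;> rcases hb with hb | hb
    · exact hC.chain ha hb hab
    · exact Or.inl ((hC.le a ha).trans (hDle b hb))
    · exact Or.inr ((hC.le b hb).trans (hDle a ha))
    · exact hDc ha hb hab
  · simp only [Finset.coe_union, Set.mem_union, Finset.mem_coe] at hz ⊢
    rcases hz p (Or.inl hC.mem) with h | h
    · exact Or.inr (hDm z h fun q hq => (hz q (Or.inr hq)).symm)
    · exact Or.inl (hC.maximal z h fun q hq => hz q (Or.inl hq))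

variable [Fintype P]

theorem exists_isMaxChain_superset {C : Set P} (hC : IsChain (· ≤ ·) C) :
    ∃ D : Finset P, IsMaxChain (· ≤ ·) (D : Set P) ∧ ∀ p ∈ C, p ∈ D := by
  classical
  obtain ⟨D, hD, hCD⟩ := hC.exists_maxChain
  exact ⟨D.toFinset, by simpa using hD, fun p hp => by simpa using hCD hp⟩

end Chains

/-! ### Potentials of labelings and rowmotion -/

section Potential

variable {P : Type} [PartialOrder P]

/-- `F p` is the largest sum of `x` over the maximal chains of the principal ideal of `p`. -/
structure IsLowerPotential (x F : P → ℝ) : Prop where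
  of_isMin : ∀ p, IsMin p → F p = x p
  le_of_covBy : ∀ p q, q ⋖ p → x p + F q ≤ F p
  exists_eq : ∀ p, ¬ IsMin p → ∃ q, q ⋖ p ∧ F p = x p + F q

/-- `-F p` is the largest sum of `y` over the maximal chains of the principal filter of `p`. -/
structure IsUpperPotential (y F : P → ℝ) : Prop where
  of_isMax : ∀ p, IsMax p → y p = -F p
  le_of_covBy : ∀ p q, p ⋖ q → y p + F p ≤ F q
  exists_eq : ∀ p, ¬ IsMax p → ∃ q, p ⋖ q ∧ y p + F p = F q

theorem IsUpperPotential.dual {y F : P → ℝ} (h : IsUpperPotential y F) :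
    IsLowerPotential (P := Pᵒᵈ) y fun p => -F p where
  of_isMin := fun p hp => by rw [h.of_isMax p hp]
  le_of_covBy := fun p q hq => by
    have := h.le_of_covBy p q hq.ofDual
    linarith
  exists_eq := fun p hp => by
    obtain ⟨q, hq, e⟩ := h.exists_eq p hp
    exact ⟨q, hq.toDual, by linarith⟩

theorem IsLowerPotential.unique_labeling {x x' F : P → ℝ} (h : IsLowerPotential x F)
    (h' : IsLowerPotential x' F) : x = x' := by
  funext p
  by_cases hm : IsMin p
  · rw [← h.of_isMin p hm, h'.of_isMin p hm]
  · obtain ⟨q, hq, e⟩ := h.exists_eq p hm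
    obtain ⟨q', hq', e'⟩ := h'.exists_eq p hm
    have := h.le_of_covBy p q' hq'
    have := h'.le_of_covBy p q hq
    linarith

open Classical in
theorem IsLowerPotential.sum_le {x F : P → ℝ} (h : IsLowerPotential x F) [Finite P] {C : Finset P}
    (hC : IsMaxChain (· ≤ ·) (C : Set P)) {p : P} (hp : p ∈ C) :
    (∑ z ∈ C with z < p, x z) + x p ≤ F p := by
  induction p using WellFoundedLT.induction with
  | ind p ih =>
    by_cases hm : IsMin p
    · rw [sum_filter_lt_of_isMin hm, h.of_isMin p hm, zero_add]
    · obtain ⟨q, hq, hqp⟩ := exists_covBy_mem hC hp hm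
      rw [sum_filter_lt_of_covBy hC.1 hq hqp]
      have := ih q hqp.1 hq
      have := h.le_of_covBy p q hqp
      linarith

theorem IsLowerPotential.exists_chain {x F : P → ℝ} (h : IsLowerPotential x F) [Finite P] (p : P) :
    ∃ C : Finset P, IsLowerChain p C ∧ ∑ z ∈ C, x z = F p := by
  classical
  induction p using WellFoundedLT.induction with
  | ind p ih =>
    by_cases hm : IsMin p
    · exact ⟨{p}, .singleton hm, by simp [h.of_isMin p hm]⟩
    · obtain ⟨q, hqp, hF⟩ := h.exists_eq p hm
      obtain ⟨C, hC, hs⟩ := ih q hqp.1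
      exact ⟨insert p C, hC.insert_of_covBy hqp, by rw [hC.sum_insert hqp, hs, hF]⟩

open Classical in
theorem IsUpperPotential.sum_le {y F : P → ℝ} (h : IsUpperPotential y F) [Finite P] {C : Finset P}
    (hC : IsMaxChain (· ≤ ·) (C : Set P)) {p : P} (hp : p ∈ C) :
    (∑ z ∈ C with p < z, y z) + y p ≤ -F p :=
  h.dual.sum_le (C := C) (p := p) hC.symm hp

theorem IsUpperPotential.exists_chain {y F : P → ℝ} (h : IsUpperPotential y F) [Finite P] (p : P) :
    ∃ C : Finset P, IsUpperChain p C ∧ ∑ z ∈ C, y z = -F p :=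
  h.dual.exists_chain p

variable [Fintype P]

open Classical in
-- A maximal chain through p splits at p, and its two halves can be chosen independently. The lower
-- half contributes at most F p, the upper half at most the maximum of -F q over the covers q of p
-- (nothing if p is maximal); the total is -y p.
theorem sup'_maxChainsThrough_eq {x y F z : P → ℝ} (hx : IsLowerPotential x F)
    (hy : IsUpperPotential y F) (p : P) (hlow : ∀ q ≤ p, z q = x q) (hup : ∀ q, p < q → z q = y q) :
    (maxChainsThrough p).sup' (maxChainsThrough_nonempty p) (fun C => ∑ q ∈ C, z q) = -y p := by
  have hsplit : ∀ C : Finset P, IsChain (· ≤ ·) (C : Set P) → p ∈ C →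
      ∑ q ∈ C, z q = (∑ q ∈ C with q < p, x q) + x p + ∑ q ∈ C with p < q, y q := by
    intro C hC hp
    rw [sum_eq_sum_lt_add_sum_gt hC hp, hlow p le_rfl]
    rw [Finset.sum_congr rfl fun q hq => hlow q (Finset.mem_filter.1 hq).2.le,
      Finset.sum_congr rfl fun q hq => hup q (Finset.mem_filter.1 hq).2]
  apply le_antisymm
  · refine Finset.sup'_le _ _ fun C hC => ?_
    simp only [maxChainsThrough, Finset.mem_filter, Finset.mem_univ, true_and] at hC
    rw [hsplit C hC.1.1 hC.2]
    have h1 := hx.sum_le hC.1 hC.2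
    by_cases hm : IsMax p
    · rw [sum_filter_gt_of_isMax hm, hy.of_isMax p hm]
      linarith
    · obtain ⟨q, hq, hpq⟩ := exists_covBy_mem_of_not_isMax hC.1 hC.2 hm
      rw [sum_filter_gt_of_covBy hC.1.1 hq hpq]
      have h2 := hy.sum_le hC.1 hq
      have h3 := hy.le_of_covBy p q hpq
      linarith
  · obtain ⟨C, hC, hCs⟩ := hx.exists_chain p
    obtain ⟨D, hD, hDs⟩ : ∃ D : Finset P, IsUpperChain p D ∧ ∑ z ∈ D, y z = -F p :=
      hy.exists_chain p
    have hmc := hC.isMaxChain_union hD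
    have hmem : C ∪ D ∈ maxChainsThrough p := by
      simp only [maxChainsThrough, Finset.mem_filter, Finset.mem_univ, true_and]
      exact ⟨hmc, Finset.mem_union_left _ hC.mem⟩
    refine le_trans ?_ (Finset.le_sup' (fun C => ∑ q ∈ C, z q) hmem)
    have hDle : ∀ q ∈ D, p ≤ q := hD.le
    have hlt : (C ∪ D).filter (· < p) = C.filter (· < p) := by
      rw [Finset.filter_union, Finset.filter_false_of_mem (s := D), Finset.union_empty]
      exact fun q hq => (hDle q hq).not_gt
    have hgt : (C ∪ D).filter (p < ·) = D.filter (p < ·) := by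
      rw [Finset.filter_union, Finset.filter_false_of_mem (s := C), Finset.empty_union]
      exact fun q hq => (hC.le q hq).not_gt
    have e1 := sum_eq_sum_lt_add_sum_gt hC.chain hC.mem x
    have e2 := sum_eq_sum_lt_add_sum_gt (C := D) hD.chain.symm hD.mem y
    rw [Finset.filter_false_of_mem (p := (p < ·)) (s := C)
      fun q hq => (hC.le q hq).not_gt, Finset.sum_empty] at e1
    rw [Finset.filter_false_of_mem (p := (· < p)) (s := D)
      fun q hq => (hDle q hq).not_gt, Finset.sum_empty] at e2
    change _ ≤ ∑ q ∈ C ∪ D, z q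
    rw [hsplit _ hmc.1 (Finset.mem_union_left _ hC.mem), hlt, hgt]
    linarith

/-- Inverse rowmotion in terms of a common potential. -/
theorem rowmotion_symm_eq {x y F : P → ℝ} (L : LinExt P) (hx : IsLowerPotential x F)
    (hy : IsUpperPotential y F) : (rowmotion L).symm x = y := by
  classical
  set n := Fintype.card P with hn
  -- Downward induction on m: once the toggles at positions m and above have acted, the labels are y
  -- there and still x below.
  have key : ∀ m ≤ n, ((List.ofFn fun i => toggle (L.toEquiv.symm i)).drop m).foldr
      (fun t z => t z) x = fun p => if m ≤ (L.toEquiv p : ℕ) then y p else x p := by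
    intro m hm
    induction hm using Nat.decreasingInduction with
    | self =>
      rw [List.drop_of_length_le (by simp [hn])]
      funext p
      have := (L.toEquiv p).2
      simp only [List.foldr_nil]
      rw [if_neg (by omega)]
    | of_succ m hm ih =>
      rw [List.drop_eq_getElem_cons (by simpa [hn] using hm), List.foldr_cons, ih,
        List.getElem_ofFn]
      set p := L.toEquiv.symm ⟨m, hm⟩ with hp
      have hLp : (L.toEquiv p : ℕ) = m := by simp [hp]
      change toggleFun p _ = _
      funext q
      by_cases hqp : q = p
      · rw [hqp, toggleFun_apply_self, if_pos hLp.ge,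
          sup'_maxChainsThrough_eq hx hy p (fun a ha => ?_) (fun a ha => ?_), neg_neg]
        · have : (L.toEquiv a : ℕ) ≤ L.toEquiv p := L.monotone ha
          rw [if_neg (by omega)]
        · have h1 : (L.toEquiv p : ℕ) ≤ L.toEquiv a := L.monotone ha.le
          have h2 : (L.toEquiv p : ℕ) ≠ L.toEquiv a := fun h =>
            ha.ne (L.toEquiv.injective (Fin.ext h))
          rw [if_pos (by omega)]
      · rw [toggleFun_apply_of_ne _ _ hqp]
        have : (L.toEquiv q : ℕ) ≠ m := fun h =>
          hqp (L.toEquiv.injective (Fin.ext (h.trans hLp.symm)))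
        exact if_congr (by omega) rfl rfl
  have h0 := key 0 (Nat.zero_le _)
  simp only [List.drop_zero, Nat.zero_le, if_true] at h0
  -- Since toggles are involutions, inverting the reversed product restores the list order, so the
  -- top toggle acts first.
  have hinv : ∀ (l : List (Equiv.Perm (P → ℝ))), (∀ t ∈ l, t⁻¹ = t) →
      ∀ z, (l.reverse.prod)⁻¹ z = l.foldr (fun t z => t z) z := by
    intro l
    induction l with
    | nil => intro _ z; rfl
    | cons t l ih =>
      intro h z
      rw [List.reverse_cons, List.prod_append, List.prod_singleton, mul_inv_rev, List.foldr_cons,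
        Equiv.Perm.mul_apply, ih (fun u hu => h u (List.mem_cons_of_mem _ hu)),
        h t List.mem_cons_self]
  refine Eq.trans ?_ h0
  refine hinv _ (fun t ht => ?_) x
  obtain ⟨i, rfl⟩ := (List.mem_ofFn' _ _).1 ht
  rfl

open Classical in
/-- The lower potential of a labeling, by recursion. -/
def lowerPotential (x : P → ℝ) (p : P) : ℝ :=
  x p + if h : (Finset.univ.filter (· ⋖ p)).attach.Nonempty then
    (Finset.univ.filter (· ⋖ p)).attach.sup' h fun q => lowerPotential x q.1 else 0
termination_by wellFounded_lt.wrap p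
decreasing_by
  have := q.2
  simp only [Finset.mem_filter] at this
  exact this.2.1

theorem lowerPotential_isLowerPotential (x : P → ℝ) : IsLowerPotential x (lowerPotential x) := by
  classical
  refine ⟨fun p hp => ?_, fun p q hqp => ?_, fun p hp => ?_⟩
  · rw [lowerPotential, dif_neg, add_zero]
    rintro ⟨q, -⟩
    have := q.2
    simp only [Finset.mem_filter] at this
    exact hp.not_lt this.2.1
  · have hq : q ∈ Finset.univ.filter (· ⋖ p) := by simp [hqp]
    rw [lowerPotential.eq_1 x p, dif_pos ⟨⟨q, hq⟩, Finset.mem_attach _ _⟩]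
    gcongr
    exact Finset.le_sup' (fun q : {q // q ∈ Finset.univ.filter (· ⋖ p)} => lowerPotential x q.1)
      (Finset.mem_attach _ ⟨q, hq⟩)
  · obtain ⟨z, hz⟩ := not_isMin_iff.1 hp
    obtain ⟨q, -, hqp⟩ := exists_le_covBy_of_lt hz
    have hq : q ∈ Finset.univ.filter (· ⋖ p) := by simp [hqp]
    rw [lowerPotential.eq_1 x p, dif_pos ⟨⟨q, hq⟩, Finset.mem_attach _ _⟩]
    obtain ⟨a, -, ha⟩ := Finset.exists_mem_eq_sup' (⟨⟨q, hq⟩, Finset.mem_attach _ _⟩ :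
      (Finset.univ.filter (· ⋖ p)).attach.Nonempty) fun q => lowerPotential x q.1
    have := a.2
    simp only [Finset.mem_filter] at this
    exact ⟨a.1, this.2, by rw [ha]⟩

theorem exists_isLowerPotential (x : P → ℝ) : ∃ F, IsLowerPotential x F :=
  ⟨_, lowerPotential_isLowerPotential x⟩

theorem exists_isUpperPotential (F : P → ℝ) : ∃ y, IsUpperPotential y F := by
  classical
  have : ∀ p, ∃ t : ℝ, (IsMax p → t = -F p) ∧ (∀ q, p ⋖ q → t + F p ≤ F q) ∧
      (¬ IsMax p → ∃ q, p ⋖ q ∧ t + F p = F q) := by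
    intro p
    by_cases hp : IsMax p
    · exact ⟨-F p, fun _ => rfl, fun q hq => absurd hq.1 hp.not_lt, fun h => absurd hp h⟩
    · obtain ⟨z, hz⟩ := not_isMax_iff.1 hp
      obtain ⟨q, hpq, -⟩ := exists_covBy_le_of_lt hz
      obtain ⟨a, ha, hmin⟩ := Finset.exists_min_image (Finset.univ.filter (p ⋖ ·)) F
        ⟨q, by simp [hpq]⟩
      simp only [Finset.mem_filter, Finset.mem_univ, true_and] at ha hmin
      refine ⟨F a - F p, fun h => absurd h hp, fun b hb => ?_, fun _ => ⟨a, ha, by ring⟩⟩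
      have := hmin b hb
      linarith
  choose y h1 h2 h3 using this
  exact ⟨y, h1, h2, h3⟩

end Potential

/-! ### Chain shifting on the grid -/

section Grid

/-- Membership in `I r s k`, in coordinates. -/
def InI (r s k i j : ℕ) : Prop :=
  1 ≤ i ∧ 1 ≤ j ∧ j ≤ s ∧ i < r + j ∧ ((j ≤ k ∧ k < i + j) ∨ (k ≤ i ∧ i < r + k ∧ k < j))

/-- Labelings `X` of `I r s (k + 1)` and `Y` of `I r s k` with a common potential `F`. -/
structure ShiftData (r s k : ℕ) (X F Y : ℕ → ℕ → ℝ) : Prop where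
  one_le : 1 ≤ k
  lt : k < s
  le : s ≤ r
  x_up : ∀ i j, 1 ≤ i → i ≤ k → j ≤ k → k < i + j → X i (j + 1) = F i (j + 1) - F i j
  x_right : ∀ i j, k ≤ i → ((j = 1 ∧ i + 1 ≤ r) ∨ (2 ≤ j ∧ j ≤ k + 1 ∧ i + 2 = r + j) ∨
    (k + 2 ≤ j ∧ j ≤ s ∧ i + 1 ≤ r + k)) → X (i + 1) j = F (i + 1) j - F i j
  x_max : ∀ i j, k ≤ i → 1 ≤ j → j ≤ k → i + 1 < r + j →
    X (i + 1) (j + 1) = F (i + 1) (j + 1) - max (F i (j + 1)) (F (i + 1) j)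
  y_up : ∀ i j, 1 ≤ i → 1 ≤ j → j ≤ k → ((i < k ∧ k < i + j) ∨ i + 1 = r + j) →
    Y i j = F i (j + 1) - F i j
  y_right : ∀ i j, k ≤ i → i + 1 ≤ r + k → k < j → j ≤ s → Y i j = F (i + 1) j - F i j
  y_min : ∀ i j, k ≤ i → 1 ≤ j → j ≤ k → i + 1 < r + j →
    Y i j = min (F (i + 1) j) (F i (j + 1)) - F i j

variable {r s k : ℕ} {X F Y : ℕ → ℕ → ℝ}

namespace ShiftData

variable (h : ShiftData r s k X F Y)
include h

theorem x_le_up {i j : ℕ} (hI : InI r s k i j) (hj : j ≤ k) :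
    X i (j + 1) ≤ F i (j + 1) - F i j := by
  obtain ⟨h1, h2, h3, h4, h5⟩ := hI
  have := h.one_le
  by_cases hi : i ≤ k
  · exact (h.x_up i j h1 hi hj (by omega)).le
  · obtain ⟨i, rfl⟩ : ∃ i', i = i' + 1 := ⟨i - 1, by omega⟩
    rw [h.x_max i j (by omega) h2 hj h4]
    linarith [le_max_right (F i (j + 1)) (F (i + 1) j)]

theorem x_le_right {i j : ℕ} (hI : InI r s k i j) (hi : k ≤ i) (h' : k < j ∨ i + 1 < r + j) :
    X (i + 1) j ≤ F (i + 1) j - F i j := by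
  obtain ⟨h1, h2, h3, h4, h5⟩ := hI
  have := h.one_le
  have := h.lt
  have := h.le
  by_cases hc : (j = 1 ∧ i + 1 ≤ r) ∨ (2 ≤ j ∧ j ≤ k + 1 ∧ i + 2 = r + j) ∨
    (k + 2 ≤ j ∧ j ≤ s ∧ i + 1 ≤ r + k)
  · exact (h.x_right i j hi hc).le
  · obtain ⟨j, rfl⟩ : ∃ j', j = j' + 1 := ⟨j - 1, by omega⟩
    rw [h.x_max i j hi (by omega) (by omega) (by omega)]
    linarith [le_max_left (F i (j + 1)) (F (i + 1) j)]

theorem y_le_up {i j : ℕ} (hI : InI r s k i j) (hj : j ≤ k) :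
    Y i j ≤ F i (j + 1) - F i j := by
  obtain ⟨h1, h2, h3, h4, h5⟩ := hI
  by_cases hi : (i < k ∧ k < i + j) ∨ i + 1 = r + j
  · exact (h.y_up i j h1 h2 hj hi).le
  · rw [h.y_min i j (by omega) h2 hj (by omega)]
    linarith [min_le_right (F (i + 1) j) (F i (j + 1))]

theorem y_le_right {i j : ℕ} (hI : InI r s k i j) (hi : k ≤ i) (h' : k < j ∨ i + 1 < r + j) :
    Y i j ≤ F (i + 1) j - F i j := by
  obtain ⟨h1, h2, h3, h4, h5⟩ := hI
  by_cases hj : k < j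
  · exact (h.y_right i j hi (by omega) hj h3).le
  · rw [h.y_min i j hi h2 (by omega) (by omega)]
    linarith [min_le_left (F (i + 1) j) (F i (j + 1))]

/-- The diagonal exchange. Inside M_k it is min + max = sum for one pair of values of F; elsewhere
both labels are single differences of F and the identity telescopes. -/
theorem star {i j : ℕ} (hI : InI r s k i j)
    (h' : (i < k ∧ j ≤ k) ∨ (j ≤ k ∧ i + 1 < r + j) ∨ (k < j ∧ j + 1 ≤ s)) :
    Y i j + F i j + F (i + 1) (j + 1) - X (i + 1) (j + 1) = F (i + 1) j + F i (j + 1) := by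
  obtain ⟨h1, h2, h3, h4, h5⟩ := hI
  have := h.one_le
  have := h.lt
  have := h.le
  by_cases hj : k < j
  · rw [h.y_right i j (by omega) (by omega) hj h3, h.x_right i (j + 1) (by omega) (by omega)]
    ring
  · by_cases hi : i < k
    · rw [h.y_up i j h1 h2 (by omega) (by omega),
        h.x_up (i + 1) j (by omega) (by omega) (by omega) (by omega)]
      ring
    · rw [h.y_min i j (by omega) h2 (by omega) (by omega),
        h.x_max i j (by omega) h2 (by omega) (by omega)]
      linarith [min_add_max (F (i + 1) j) (F i (j + 1)), max_comm (F (i + 1) j) (F i (j + 1))]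

end ShiftData

/-! #### Prefixes of chains of `I r s (k + 1)` -/

/-- There is a saturated chain of `I r s (k + 1)`, of weight at least `w`, from a minimal element
other than `(k + 1, 1)` to `(i, j)` which stays in the rows up to `k + 1`. -/
inductive FreePrefix (r s k : ℕ) (X : ℕ → ℕ → ℝ) : ℕ → ℕ → ℝ → Prop
  | start {i j w} : 1 ≤ i → i ≤ k → i + j = k + 2 → w ≤ X i j → FreePrefix r s k X i j w
  | right {i j w w'} : FreePrefix r s k X i j w → i + 1 < r + j → w' ≤ w + X (i + 1) j →
      FreePrefix r s k X (i + 1) j w'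
  | up {i j w w'} : FreePrefix r s k X i j w → j ≤ k → w' ≤ w + X i (j + 1) →
      FreePrefix r s k X i (j + 1) w'

/-- There is a saturated chain of `I r s (k + 1)`, of weight at least `w`, from a minimal element
to `(i, j)` which starts at `(k + 1, 1)` or meets the left border. -/
inductive PolyPrefix (r s k : ℕ) (X : ℕ → ℕ → ℝ) : ℕ → ℕ → ℝ → Prop
  | start {w} : w ≤ X (k + 1) 1 → PolyPrefix r s k X (k + 1) 1 w
  | border {i j w} : FreePrefix r s k X i j w → i + 1 = r + j → PolyPrefix r s k X i j w
  | right {i j w w'} : PolyPrefix r s k X i j w → InI r s (k + 1) (i + 1) j →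
      w' ≤ w + X (i + 1) j → PolyPrefix r s k X (i + 1) j w'
  | up {i j w w'} : PolyPrefix r s k X i j w → InI r s (k + 1) i (j + 1) →
      w' ≤ w + X i (j + 1) → PolyPrefix r s k X i (j + 1) w'

theorem FreePrefix.mono {i j : ℕ} {w w' : ℝ} (hp : FreePrefix r s k X i j w) (hw : w' ≤ w) :
    FreePrefix r s k X i j w' := by
  cases hp with
  | start h1 h2 h3 h4 => exact .start h1 h2 h3 (hw.trans h4)
  | right h1 h2 h3 => exact .right h1 h2 (hw.trans h3)
  | up h1 h2 h3 => exact .up h1 h2 (hw.trans h3)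

theorem PolyPrefix.mono {i j : ℕ} {w w' : ℝ} (hp : PolyPrefix r s k X i j w) (hw : w' ≤ w) :
    PolyPrefix r s k X i j w' := by
  cases hp with
  | start h1 => exact .start (hw.trans h1)
  | border h1 h2 => exact .border (h1.mono hw) h2
  | right h1 h2 h3 => exact .right h1 h2 (hw.trans h3)
  | up h1 h2 h3 => exact .up h1 h2 (hw.trans h3)

theorem FreePrefix.inI (h : ShiftData r s k X F Y) {i j : ℕ} {w : ℝ}
    (hp : FreePrefix r s k X i j w) : InI r s (k + 1) i j ∧ 2 ≤ j ∧ j ≤ k + 1 := by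
  have h0 := h.one_le
  have := h.lt
  have := h.le
  induction hp with
  | start h1 h2 h3 h4 => unfold InI; omega
  | right h1 h2 h3 ih => unfold InI at *; omega
  | up h1 h2 h3 ih => unfold InI at *; omega

theorem PolyPrefix.inI (h : ShiftData r s k X F Y) {i j : ℕ} {w : ℝ}
    (hp : PolyPrefix r s k X i j w) : InI r s (k + 1) i j ∧ k + 1 ≤ i := by
  have h0 := h.one_le
  have := h.lt
  have := h.le
  induction hp with
  | start h1 => unfold InI; omega
  | border h1 h2 => have := h1.inI h; unfold InI at *; omega
  | right h1 h2 h3 ih => exact ⟨h2, by omega⟩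
  | up h1 h2 h3 ih => exact ⟨h2, by omega⟩

/-- The end of a prefix moves up or back to the left without changing w - F at the end; both moves
are proved together by induction on i + j. To go up when the maximum in X at the target is attained
on its left, go left, up, right. To go left after a final up step, drop that step, go left one row
lower, then up. -/
theorem FreePrefix.shift (h : ShiftData r s k X F Y) (n : ℕ) :
    (∀ i j w, i + j = n → FreePrefix r s k X i j w → j ≤ k →
      FreePrefix r s k X i (j + 1) (w + F i (j + 1) - F i j)) ∧
    ∀ i j w, i + j = n → k ≤ i → FreePrefix r s k X (i + 1) j w →
      FreePrefix r s k X i j (w - F (i + 1) j + F i j) := by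
  have h0 := h.one_le
  have hlt := h.lt
  have hle := h.le
  induction n with
  | zero =>
    refine ⟨fun i j w hn hp => ?_, fun i j w hn hi => ?_⟩
    · have := hp.inI h; omega
    · omega
  | succ n ih =>
    obtain ⟨ihA, ihB⟩ := ih
    constructor
    · intro i j w hn hp hj
      obtain ⟨⟨d1, d2, d3, d4, d5⟩, d6, d7⟩ := hp.inI h
      by_cases hi : i ≤ k
      · refine .up hp hj ?_
        rw [h.x_up i j d1 hi hj (by omega)]
        linarith
      · obtain ⟨i, rfl⟩ : ∃ i', i = i' + 1 := ⟨i - 1, by omega⟩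
        have hx := h.x_max i j (by omega) (by omega) hj d4
        rcases max_choice (F i (j + 1)) (F (i + 1) j) with hm | hm
        · refine .right (ihA i j _ (by omega) (ihB i j _ (by omega) (by omega) hp) hj) (by omega) ?_
          rw [hx, hm]
          linarith
        · refine .up hp hj ?_
          rw [hx, hm]
          linarith
    · intro i j w hn hi hp
      obtain ⟨hI, d6, d7⟩ := hp.inI h
      have hI' : InI r s k i j ∨ j = k + 1 := by unfold InI at *; omega
      cases hp with
      | start h1 h2 h3 h4 => omega
      | right h1 h2 h3 =>
        refine h1.mono ?_
        have := h.x_le_right (i := i) (j := j) (by unfold InI at *; omega) hi (by omega)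
        linarith
      | @up _ j w0 _ h1 h2 h3 =>
        have hd := h1.inI h
        have := ihA i j _ (by omega) (ihB i j _ (by omega) hi h1) h2
        refine this.mono ?_
        have := h.x_le_up (i := i + 1) (j := j) (by unfold InI at *; omega) h2
        linarith

/-- The mirror image of `FreePrefix.shift`, with moves to the right and down. Here the prefix must
also remain polygonal. -/
theorem PolyPrefix.shift (h : ShiftData r s k X F Y) (n : ℕ) :
    (∀ i j w, i + j = n → PolyPrefix r s k X i j w → InI r s (k + 1) (i + 1) j →
      PolyPrefix r s k X (i + 1) j (w + F (i + 1) j - F i j)) ∧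
    ∀ i j w, i + j = n → 1 ≤ j → j ≤ k → i < r + j → PolyPrefix r s k X i (j + 1) w →
      PolyPrefix r s k X i j (w - F i (j + 1) + F i j) := by
  have h0 := h.one_le
  have hlt := h.lt
  have hle := h.le
  induction n with
  | zero =>
    refine ⟨fun i j w hn hp => ?_, fun i j w hn hj => ?_⟩
    · have := hp.inI h; omega
    · omega
  | succ n ih =>
    obtain ⟨ihA, ihB⟩ := ih
    constructor
    · intro i j w hn hp hI
      obtain ⟨⟨d1, d2, d3, d4, d5⟩, d6⟩ := hp.inI h
      have hI' := hI
      obtain ⟨e1, e2, e3, e4, e5⟩ := hI'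
      by_cases hc : (j = 1 ∧ i + 1 ≤ r) ∨ (2 ≤ j ∧ j ≤ k + 1 ∧ i + 2 = r + j) ∨
        (k + 2 ≤ j ∧ j ≤ s ∧ i + 1 ≤ r + k)
      · refine .right hp hI ?_
        rw [h.x_right i j (by omega) hc]
        linarith
      · obtain ⟨j, rfl⟩ : ∃ j', j = j' + 1 := ⟨j - 1, by omega⟩
        have hx := h.x_max i j (by omega) (by omega) (by omega) (by omega)
        rcases max_choice (F i (j + 1)) (F (i + 1) j) with hm | hm
        · refine .right hp hI ?_
          rw [hx, hm]
          linarith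
        · have h1 := ihB i j _ (by omega) (by omega) (by omega) (by omega) hp
          have h2 := ihA i j _ (by omega) h1 (by unfold InI; omega)
          refine .up h2 hI ?_
          rw [hx, hm]
          linarith
    · intro i j w hn hj hjk hij hp
      obtain ⟨hI, d6⟩ := hp.inI h
      cases hp with
      -- The initial cases never have to move down: (k+1, 1) is in the first row, and a border end
      -- at (i, j+1) would have i = r + j. So the feature making the prefix polygonal is never
      -- discarded.
      | start h1 => omega
      | border h1 h2 => omega
      | @right i _ w0 _ h1 h2 h3 =>
        have hd := h1.inI h
        have a1 := ihB i j _ (by omega) hj hjk (by omega) h1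
        have a2 := ihA i j _ (by omega) a1 (by unfold InI at *; omega)
        refine a2.mono ?_
        have hx := h.x_max i j (by omega) (by omega) (by omega) (by omega)
        have := le_max_left (F i (j + 1)) (F (i + 1) j)
        linarith
      | up h1 h2 h3 =>
        refine h1.mono ?_
        have := h.x_le_up (i := i) (j := j) (by unfold InI at *; omega) hjk
        linarith

/-! ### Carrying a prefix along one step of a chain of I_k -/

namespace ShiftData

variable (h : ShiftData r s k X F Y)
include h

/-- The invariant of the following lemmas: if w is the weight of a chain of I_k strictly below (i,
j), the carried prefix has reduced weight w - F i j and ends at (i, j+1) if free, at (i+1, j) if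
polygonal. -/
theorem freePrefix_start {i j : ℕ} (hi : 1 ≤ i) (hj : 1 ≤ j) (hij : i + j = k + 1) :
    FreePrefix r s k X i (j + 1) (0 - F i j + F i (j + 1)) := by
  refine .start hi (by omega) (by omega) ?_
  rw [h.x_up i j hi (by omega) (by omega) (by omega)]
  linarith

theorem freePrefix_up {i j : ℕ} {w : ℝ} (hI : InI r s k i j) (hj : j + 1 ≤ k)
    (hp : FreePrefix r s k X i (j + 1) (w - F i j + F i (j + 1))) :
    FreePrefix r s k X i (j + 2) (w + Y i j - F i (j + 1) + F i (j + 2)) := by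
  refine ((FreePrefix.shift h _).1 i (j + 1) _ rfl hp hj).mono ?_
  have := h.y_le_up hI (by omega)
  linarith

theorem freePrefix_right {i j : ℕ} {w : ℝ} (hI : InI r s k i j) (hj : j ≤ k)
    (hI' : InI r s k (i + 1) j)
    (hp : FreePrefix r s k X i (j + 1) (w - F i j + F i (j + 1))) :
    FreePrefix r s k X (i + 1) (j + 1) (w + Y i j - F (i + 1) j + F (i + 1) (j + 1)) := by
  refine .right hp (by unfold InI at *; omega) ?_
  have := h.star hI (by unfold InI at *; omega)
  linarith

theorem polyPrefix_start : PolyPrefix r s k X (k + 1) 1 (0 - F k 1 + F (k + 1) 1) := by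
  have h0 := h.one_le
  have hlt := h.lt
  have hle := h.le
  refine .start ?_
  rw [h.x_right k 1 le_rfl (by omega)]
  linarith

theorem polyPrefix_right {i j : ℕ} {w : ℝ} (hI : InI r s k i j) (hI' : InI r s k (i + 1) j)
    (hb : i + 2 < r + j) (hp : PolyPrefix r s k X (i + 1) j (w - F i j + F (i + 1) j)) :
    PolyPrefix r s k X (i + 2) j (w + Y i j - F (i + 1) j + F (i + 2) j) := by
  have hd := hp.inI h
  refine ((PolyPrefix.shift h _).1 (i + 1) j _ rfl hp (by unfold InI at *; omega)).mono ?_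
  have := h.y_le_right hI (by omega) (by omega)
  linarith

theorem polyPrefix_up {i j : ℕ} {w : ℝ} (hI : InI r s k i j) (hI' : InI r s k i (j + 1))
    (hp : PolyPrefix r s k X (i + 1) j (w - F i j + F (i + 1) j)) :
    PolyPrefix r s k X (i + 1) (j + 1) (w + Y i j - F i (j + 1) + F (i + 1) (j + 1)) := by
  have hd := hp.inI h
  refine .up hp (by unfold InI at *; omega) ?_
  have := h.star hI (by unfold InI at *; omega)
  linarith

/-- The change of type: when the chain of I_k leaves a border point (i, j) upwards, the free prefix
at (i, j+1) steps right to (i+1, j+1), which is again on the border. -/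
theorem polyPrefix_border {i j : ℕ} {w : ℝ} (hI : InI r s k i j) (hj : j ≤ k) (hb : i + 1 = r + j)
    (hp : FreePrefix r s k X i (j + 1) (w - F i j + F i (j + 1))) :
    PolyPrefix r s k X (i + 1) (j + 1) (w + Y i j - F i (j + 1) + F (i + 1) (j + 1)) := by
  have h0 := h.one_le
  have hlt := h.lt
  have hle := h.le
  refine .border (.right hp (by omega) ?_) (by omega)
  rw [h.x_right i (j + 1) (by omega) (by unfold InI at hI; omega)]
  have := h.y_le_up hI hj
  linarith

/-- At the maximum of I_k the correction by F is exactly the last label, so the full weight is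
reached. -/
theorem polyPrefix_end {w : ℝ}
    (hp : PolyPrefix r s k X (r + k) s (w - F (r + k - 1) s + F (r + k) s)) :
    PolyPrefix r s k X (r + k) s (w + Y (r + k - 1) s) := by
  have h0 := h.one_le
  have hlt := h.lt
  have hle := h.le
  refine hp.mono ?_
  rw [h.y_right (r + k - 1) s (by omega) (by omega) hlt le_rfl,
    show r + k - 1 + 1 = r + k by omega]
  linarith

end ShiftData

/-! #### Suffixes of chains of `I r s k` -/

/-- There is a saturated chain of `I r s k` from `(i, j)` to the maximum, of weight at
least `w`. -/
inductive FreeSuffix (r s k : ℕ) (Y : ℕ → ℕ → ℝ) : ℕ → ℕ → ℝ → Prop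
  | top {w} : w ≤ Y (r + k - 1) s → FreeSuffix r s k Y (r + k - 1) s w
  | right {i j w w'} : FreeSuffix r s k Y (i + 1) j w → InI r s k i j → w' ≤ w + Y i j →
      FreeSuffix r s k Y i j w'
  | up {i j w w'} : FreeSuffix r s k Y i (j + 1) w → InI r s k i j → w' ≤ w + Y i j →
      FreeSuffix r s k Y i j w'

/-- There is a saturated chain of `I r s k` from `(i, j)` to the maximum, of weight at
least `w`, which meets the left border. -/
inductive PolySuffix (r s k : ℕ) (Y : ℕ → ℕ → ℝ) : ℕ → ℕ → ℝ → Prop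
  | border {i j w} : FreeSuffix r s k Y i j w → i + 1 = r + j → j ≤ k → PolySuffix r s k Y i j w
  | right {i j w w'} : PolySuffix r s k Y (i + 1) j w → InI r s k i j → w' ≤ w + Y i j →
      PolySuffix r s k Y i j w'
  | up {i j w w'} : PolySuffix r s k Y i (j + 1) w → InI r s k i j → w' ≤ w + Y i j →
      PolySuffix r s k Y i j w'

theorem FreeSuffix.mono {i j : ℕ} {w w' : ℝ} (hp : FreeSuffix r s k Y i j w) (hw : w' ≤ w) :
    FreeSuffix r s k Y i j w' := by
  cases hp with
  | top h1 => exact .top (hw.trans h1)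
  | right h1 h2 h3 => exact .right h1 h2 (hw.trans h3)
  | up h1 h2 h3 => exact .up h1 h2 (hw.trans h3)

theorem PolySuffix.mono {i j : ℕ} {w w' : ℝ} (hp : PolySuffix r s k Y i j w) (hw : w' ≤ w) :
    PolySuffix r s k Y i j w' := by
  cases hp with
  | border h1 h2 h3 => exact .border (h1.mono hw) h2 h3
  | right h1 h2 h3 => exact .right h1 h2 (hw.trans h3)
  | up h1 h2 h3 => exact .up h1 h2 (hw.trans h3)

theorem FreeSuffix.inI (h : ShiftData r s k X F Y) {i j : ℕ} {w : ℝ}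
    (hp : FreeSuffix r s k Y i j w) : InI r s k i j := by
  have h0 := h.one_le
  have := h.lt
  have := h.le
  cases hp with
  | top h1 => unfold InI; omega
  | right h1 h2 h3 => exact h2
  | up h1 h2 h3 => exact h2

theorem PolySuffix.inI (h : ShiftData r s k X F Y) {i j : ℕ} {w : ℝ}
    (hp : PolySuffix r s k Y i j w) : InI r s k i j ∧ j ≤ k := by
  induction hp with
  | border h1 h2 h3 => exact ⟨h1.inI h, h3⟩
  | right h1 h2 h3 ih => exact ⟨h2, ih.2⟩
  | up h1 h2 h3 ih => exact ⟨h2, by omega⟩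

/-- The order dual of the prefix moves: the start of a suffix moves left or up while w + F at the
start is kept. The induction is on the distance r + k + s - (i + j), and the minimum defining Y
decides between a direct step and a detour. -/
theorem FreeSuffix.shift (h : ShiftData r s k X F Y) (n : ℕ) :
    (∀ i j w, i + j + n = r + k + s → FreeSuffix r s k Y (i + 1) j w → InI r s k i j → k ≤ i →
      FreeSuffix r s k Y i j (w + F (i + 1) j - F i j)) ∧
    ∀ i j w, i + j + n = r + k + s → k ≤ i → j ≤ k → FreeSuffix r s k Y i j w →
      FreeSuffix r s k Y i (j + 1) (w + F i j - F i (j + 1)) := by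
  have h0 := h.one_le
  have hlt := h.lt
  have hle := h.le
  induction n with
  | zero =>
    refine ⟨fun i j w hn hp hI hi => ?_, fun i j w hn hi hj hp => ?_⟩
    · unfold InI at hI; omega
    · have := hp.inI h; unfold InI at this; omega
  | succ n ih =>
    obtain ⟨ihA, ihB⟩ := ih
    constructor
    · intro i j w hn hp hI hi
      have hI1 := hp.inI h
      by_cases hj : k < j
      · refine .right hp hI ?_
        rw [h.y_right i j hi (by unfold InI at hI; omega) hj hI.2.2.1]
        linarith
      · have hy := h.y_min i j hi hI.2.1 (by omega) (by unfold InI at hI1; omega)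
        rcases min_choice (F (i + 1) j) (F i (j + 1)) with hm | hm
        · refine .right hp hI ?_
          rw [hy, hm]
          linarith
        · have h1 := ihB (i + 1) j _ (by omega) (by omega) (by omega) hp
          have h2 := ihA i (j + 1) _ (by omega) h1 (by unfold InI at *; omega) hi
          refine .up h2 hI ?_
          rw [hy, hm]
          linarith
    · intro i j w hn hi hj hp
      have hI := hp.inI h
      cases hp with
      | top h1 => omega
      | right h1 h2 h3 =>
        have hI1 := h1.inI h
        have a1 := ihB (i + 1) j _ (by omega) (by omega) hj h1
        have a2 := ihA i (j + 1) _ (by omega) a1 (by unfold InI at *; omega) hi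
        refine a2.mono ?_
        have := h.y_le_right hI hi (by unfold InI at hI1; omega)
        linarith
      | up h1 h2 h3 =>
        refine h1.mono ?_
        have := h.y_le_up hI hj
        linarith

theorem PolySuffix.shift (h : ShiftData r s k X F Y) (n : ℕ) :
    (∀ i j w, i + j + n = r + k + s → PolySuffix r s k Y i (j + 1) w → InI r s k i j →
      PolySuffix r s k Y i j (w + F i (j + 1) - F i j)) ∧
    ∀ i j w, i + j + n = r + k + s → k ≤ i → i + 1 < r + j → PolySuffix r s k Y i j w →
      PolySuffix r s k Y (i + 1) j (w + F i j - F (i + 1) j) := by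
  have h0 := h.one_le
  have hlt := h.lt
  have hle := h.le
  induction n with
  | zero =>
    refine ⟨fun i j w hn hp hI => ?_, fun i j w hn hi hj hp => ?_⟩
    · unfold InI at hI; omega
    · have := hp.inI h; unfold InI at this; omega
  | succ n ih =>
    obtain ⟨ihA, ihB⟩ := ih
    constructor
    · intro i j w hn hp hI
      have hI1 := hp.inI h
      by_cases hc : (i < k ∧ k < i + j) ∨ i + 1 = r + j
      · refine .up hp hI ?_
        rw [h.y_up i j hI.1 hI.2.1 (by omega) hc]
        linarith
      · have hy := h.y_min i j (by unfold InI at hI; omega) hI.2.1 (by omega)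
          (by unfold InI at hI; omega)
        rcases min_choice (F (i + 1) j) (F i (j + 1)) with hm | hm
        · have h1 := ihB i (j + 1) _ (by omega) (by unfold InI at hI; omega)
            (by unfold InI at hI; omega) hp
          have h2 := ihA (i + 1) j _ (by omega) h1 (by unfold InI at *; omega)
          refine .right h2 hI ?_
          rw [hy, hm]
          linarith
        · refine .up hp hI ?_
          rw [hy, hm]
          linarith
    · intro i j w hn hi hb hp
      have hI := hp.inI h
      cases hp with
      -- A suffix starting on the border is never moved right, since i + 1 < r + j is assumed.
      | border h1 h2 h3 => omega
      | right h1 h2 h3 =>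
        refine h1.mono ?_
        have := h.y_le_right hI.1 hi (by omega)
        linarith
      | up h1 h2 h3 =>
        have hI1 := h1.inI h
        have a1 := ihB i (j + 1) _ (by omega) hi (by omega) h1
        have a2 := ihA (i + 1) j _ (by omega) a1 (by unfold InI at *; omega)
        refine a2.mono ?_
        have := h.y_le_up hI.1 hI.2
        linarith

/-! ### Carrying a suffix down one step of a chain of I_{k+1} -/

namespace ShiftData

variable (h : ShiftData r s k X F Y)
include h

/-- The dual invariant: w is the weight of a chain of I_{k+1} strictly above a point, and the
carried suffix starts one step to the left of it if free, one step below it if polygonal. -/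
theorem freeSuffix_top :
    FreeSuffix r s k Y (r + k - 1) s (0 + F (r + k) s - F (r + k - 1) s) := by
  have h0 := h.one_le
  have hlt := h.lt
  have hle := h.le
  refine .top ?_
  rw [h.y_right (r + k - 1) s (by omega) (by omega) hlt le_rfl,
    show r + k - 1 + 1 = r + k by omega]
  linarith

theorem freeSuffix_right {i j : ℕ} {w : ℝ} (hi : k ≤ i) (hI : InI r s k i j)
    (hp : FreeSuffix r s k Y (i + 1) j (w + F (i + 2) j - F (i + 1) j))
    (hI' : InI r s (k + 1) (i + 2) j) :
    FreeSuffix r s k Y i j (w + X (i + 2) j + F (i + 1) j - F i j) := by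
  have hI1 := hp.inI h
  have hs : i + j ≤ r + k + s := by unfold InI at hI; omega
  obtain ⟨n, hn⟩ := Nat.exists_eq_add_of_le hs
  refine ((FreeSuffix.shift h n).1 i j _ hn.symm hp hI hi).mono ?_
  have := h.x_le_right hI1 (by omega) (by unfold InI at hI'; omega)
  linarith

theorem freeSuffix_up {i j : ℕ} {w : ℝ} (hI : InI r s k i j)
    (hp : FreeSuffix r s k Y i (j + 1) (w + F (i + 1) (j + 1) - F i (j + 1)))
    (hI' : InI r s (k + 1) (i + 1) j) :
    FreeSuffix r s k Y i j (w + X (i + 1) (j + 1) + F (i + 1) j - F i j) := by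
  have hI1 := hp.inI h
  refine .up hp hI ?_
  have := h.star hI (by unfold InI at *; omega)
  linarith

theorem polySuffix_up {i j : ℕ} {w : ℝ} (hI : InI r s k i j)
    (hp : PolySuffix r s k Y i (j + 1) (w + F i (j + 2) - F i (j + 1))) :
    PolySuffix r s k Y i j (w + X i (j + 2) + F i (j + 1) - F i j) := by
  have hI1 := hp.inI h
  have hs : i + j ≤ r + k + s := by unfold InI at hI; omega
  obtain ⟨n, hn⟩ := Nat.exists_eq_add_of_le hs
  refine ((PolySuffix.shift h n).1 i j _ hn.symm hp hI).mono ?_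
  have := h.x_le_up hI1.1 hI1.2
  linarith

theorem polySuffix_right {i j : ℕ} {w : ℝ} (hI : InI r s k i j)
    (hp : PolySuffix r s k Y (i + 1) j (w + F (i + 1) (j + 1) - F (i + 1) j)) :
    PolySuffix r s k Y i j (w + X (i + 1) (j + 1) + F i (j + 1) - F i j) := by
  have hI1 := hp.inI h
  refine .right hp hI ?_
  have := h.star hI (by unfold InI at *; omega)
  linarith

theorem polySuffix_border {i j : ℕ} {w : ℝ} (hI : InI r s k i j) (hj : j ≤ k) (hb : i + 1 = r + j)
    (hp : FreeSuffix r s k Y i (j + 1) (w + F (i + 1) (j + 1) - F i (j + 1))) :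
    PolySuffix r s k Y i j (w + X (i + 1) (j + 1) + F i (j + 1) - F i j) := by
  have h0 := h.one_le
  have hlt := h.lt
  have hle := h.le
  refine .border (.up hp hI ?_) hb hj
  rw [h.y_up i j hI.1 hI.2.1 hj (Or.inr hb), h.x_right i (j + 1) (by omega)
    (by unfold InI at hI; omega)]
  linarith

theorem freeSuffix_end {w : ℝ} (hp : FreeSuffix r s k Y k 1 (w + F (k + 1) 1 - F k 1)) :
    FreeSuffix r s k Y k 1 (w + X (k + 1) 1) := by
  have h0 := h.one_le
  have hlt := h.lt
  have hle := h.le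
  refine hp.mono ?_
  rw [h.x_right k 1 le_rfl (by omega)]
  linarith

theorem polySuffix_end {i j : ℕ} {w : ℝ} (hI : InI r s k i j) (hj : j ≤ k)
    (hp : PolySuffix r s k Y i j (w + F i (j + 1) - F i j)) :
    PolySuffix r s k Y i j (w + X i (j + 1)) := by
  refine hp.mono ?_
  have := h.x_le_up hI hj
  linarith

end ShiftData

end Grid

/-! ### Grid posets -/

section GridPoset

/-- Any two comparable points of `S` are joined by unit steps inside `S`. -/
def IsStepConnected (S : Finset (ℕ × ℕ)) : Prop :=
  ∀ p ∈ S, ∀ q ∈ S, p < q → ((p.1 + 1, p.2) ∈ S ∧ (p.1 + 1, p.2) ≤ q) ∨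
    ((p.1, p.2 + 1) ∈ S ∧ (p.1, p.2 + 1) ≤ q)

theorem IsStepConnected.covBy_iff {S : Finset (ℕ × ℕ)} (hS : IsStepConnected S) {p q : S} :
    p ⋖ q ↔ q.1 = (p.1.1 + 1, p.1.2) ∨ q.1 = (p.1.1, p.1.2 + 1) := by
  obtain ⟨⟨i, j⟩, hp⟩ := p
  obtain ⟨⟨i', j'⟩, hq⟩ := q
  constructor
  · intro h
    have hlt : (i, j) < (i', j') := h.1
    rcases hS _ hp _ hq hlt with ⟨hm, hle⟩ | ⟨hm, hle⟩
    · rcases hle.lt_or_eq with h' | h'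
      · exact absurd (show (⟨_, hm⟩ : S) < ⟨_, hq⟩ from h')
          (h.2 (show (⟨(i, j), hp⟩ : S) < ⟨(i + 1, j), hm⟩ from
            Prod.mk_lt_mk.2 (Or.inl ⟨by omega, le_rfl⟩)))
      · exact Or.inl h'.symm
    · rcases hle.lt_or_eq with h' | h'
      · exact absurd (show (⟨_, hm⟩ : S) < ⟨_, hq⟩ from h')
          (h.2 (show (⟨(i, j), hp⟩ : S) < ⟨(i, j + 1), hm⟩ from
            Prod.mk_lt_mk.2 (Or.inr ⟨le_rfl, by omega⟩)))
      · exact Or.inr h'.symm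
  · intro h
    simp only [Prod.mk.injEq] at h
    refine ⟨show (i, j) < (i', j') from Prod.mk_lt_mk.2 (by omega), ?_⟩
    rintro ⟨⟨a, b⟩, hab⟩ h1 h2
    have h1' : (i, j) < (a, b) := h1
    have h2' : (a, b) < (i', j') := h2
    rw [Prod.mk_lt_mk] at h1' h2'
    omega

variable {r s k : ℕ}

theorem mem_I_iff {i j : ℕ} : (i, j) ∈ I r s k ↔ InI r s k i j := by
  simp only [I, T, RT, InI, Finset.mem_filter, Finset.mem_product, Finset.mem_Icc,
    Prod.mk_le_mk]
  omega

theorem I_isStepConnected (hks : k ≤ s) : IsStepConnected (I r s k) := by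
  rintro ⟨i, j⟩ hp ⟨i', j'⟩ hq h
  rw [mem_I_iff] at hp hq ⊢
  rw [Prod.mk_lt_mk] at h
  rw [mem_I_iff]
  simp only [Prod.mk_le_mk]
  unfold InI at *
  omega

theorem add_eq_of_isMin (hk : 1 ≤ k) {p : I r s k} (hp : IsMin p) :
    p.1.1 + p.1.2 = k + 1 := by
  obtain ⟨⟨i, j⟩, hI⟩ := p
  have h := mem_I_iff.1 hI
  by_contra hne
  by_cases h1 : InI r s k (i - 1) j
  · have h2 : (⟨(i - 1, j), mem_I_iff.2 h1⟩ : I r s k) < ⟨(i, j), hI⟩ :=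
      show (i - 1, j) < (i, j) from Prod.mk_lt_mk.2 (by unfold InI at *; omega)
    exact hp.not_lt h2
  · have h1' : InI r s k i (j - 1) := by unfold InI at *; simp only at hne; omega
    have h2 : (⟨(i, j - 1), mem_I_iff.2 h1'⟩ : I r s k) < ⟨(i, j), hI⟩ :=
      show (i, j - 1) < (i, j) from Prod.mk_lt_mk.2 (by unfold InI at *; omega)
    exact hp.not_lt h2

theorem isMin_of_add_eq {p : I r s k} (hp : p.1.1 + p.1.2 = k + 1) : IsMin p := by
  rw [isMin_iff_forall_not_lt]
  rintro ⟨⟨a, b⟩, hab⟩ h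
  obtain ⟨⟨i, j⟩, hI⟩ := p
  have h1 := mem_I_iff.1 hab
  have h2 := mem_I_iff.1 hI
  have h' : (a, b) < (i, j) := h
  rw [Prod.mk_lt_mk] at h'
  unfold InI at *
  simp only at hp
  omega

theorem le_top (hk : 1 ≤ k) (hks : k ≤ s) (hsr : s ≤ r) (p : I r s k) :
    p ≤ ⟨(r + k - 1, s), mem_I_iff.2 (by unfold InI; omega)⟩ := by
  obtain ⟨⟨i, j⟩, hI⟩ := p
  have h := mem_I_iff.1 hI
  change (i, j) ≤ (r + k - 1, s)
  rw [Prod.mk_le_mk]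
  unfold InI at h
  omega

variable {X F Y : ℕ → ℕ → ℝ}

/-! ### Prefixes and suffixes as chains of the posets; transport of chain bounds -/

theorem FreePrefix.exists_chain (h : ShiftData r s k X F Y) {i j : ℕ} {w : ℝ}
    (hp : FreePrefix r s k X i j w) :
    ∃ (hI : (i, j) ∈ I r s (k + 1)) (C : Finset (I r s (k + 1))),
      IsLowerChain ⟨(i, j), hI⟩ C ∧ w ≤ ∑ p ∈ C, X p.1.1 p.1.2 := by
  classical
  have hks : k + 1 ≤ s := h.lt
  induction hp with
  | @start i j w h1 h2 h3 h4 =>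
    have hI := mem_I_iff.2 ((FreePrefix.start h1 h2 h3 h4).inI h).1
    exact ⟨hI, _, .singleton (isMin_of_add_eq (by simp only; omega)), by simpa using h4⟩
  | @right i j w w' h1 h2 h3 ih =>
    obtain ⟨hI, C, hC, hw⟩ := ih
    have hI' := mem_I_iff.2 ((FreePrefix.right h1 h2 h3).inI h).1
    have hcov : (⟨(i, j), hI⟩ : I r s (k + 1)) ⋖ ⟨(i + 1, j), hI'⟩ :=
      (I_isStepConnected hks).covBy_iff.2 (Or.inl rfl)
    refine ⟨hI', _, hC.insert_of_covBy hcov, ?_⟩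
    rw [hC.sum_insert hcov]
    simp only
    linarith
  | @up i j w w' h1 h2 h3 ih =>
    obtain ⟨hI, C, hC, hw⟩ := ih
    have hI' := mem_I_iff.2 ((FreePrefix.up h1 h2 h3).inI h).1
    have hcov : (⟨(i, j), hI⟩ : I r s (k + 1)) ⋖ ⟨(i, j + 1), hI'⟩ :=
      (I_isStepConnected hks).covBy_iff.2 (Or.inr rfl)
    refine ⟨hI', _, hC.insert_of_covBy hcov, ?_⟩
    rw [hC.sum_insert hcov]
    simp only
    linarith

theorem PolyPrefix.exists_chain (h : ShiftData r s k X F Y) {i j : ℕ} {w : ℝ}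
    (hp : PolyPrefix r s k X i j w) :
    ∃ (hI : (i, j) ∈ I r s (k + 1)) (C : Finset (I r s (k + 1))),
      IsLowerChain ⟨(i, j), hI⟩ C ∧ w ≤ ∑ p ∈ C, X p.1.1 p.1.2 ∧
      ((∃ p ∈ C, p.1.1 + 1 = p.1.2 + r) ∨ ∃ p ∈ C, p.1 = (k + 1, 1)) := by
  classical
  have hks : k + 1 ≤ s := h.lt
  induction hp with
  | start h1 =>
    have hI := mem_I_iff.2 ((PolyPrefix.start h1).inI h).1
    exact ⟨hI, _, .singleton (isMin_of_add_eq rfl), by simpa using h1, by simp⟩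
  | border h1 h2 =>
    obtain ⟨hI, C, hC, hw⟩ := h1.exists_chain h
    exact ⟨hI, C, hC, hw, Or.inl ⟨_, hC.mem, by simp only; omega⟩⟩
  | @right i j w w' h1 h2 h3 ih =>
    obtain ⟨hI, C, hC, hw, hb⟩ := ih
    have hI' := mem_I_iff.2 h2
    have hcov : (⟨(i, j), hI⟩ : I r s (k + 1)) ⋖ ⟨(i + 1, j), hI'⟩ :=
      (I_isStepConnected hks).covBy_iff.2 (Or.inl rfl)
    refine ⟨hI', _, hC.insert_of_covBy hcov, ?_, ?_⟩
    · rw [hC.sum_insert hcov]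
      simp only
      linarith
    · exact hb.imp (fun ⟨p, hp, e⟩ => ⟨p, Finset.mem_insert_of_mem hp, e⟩)
        fun ⟨p, hp, e⟩ => ⟨p, Finset.mem_insert_of_mem hp, e⟩
  | @up i j w w' h1 h2 h3 ih =>
    obtain ⟨hI, C, hC, hw, hb⟩ := ih
    have hI' := mem_I_iff.2 h2
    have hcov : (⟨(i, j), hI⟩ : I r s (k + 1)) ⋖ ⟨(i, j + 1), hI'⟩ :=
      (I_isStepConnected hks).covBy_iff.2 (Or.inr rfl)
    refine ⟨hI', _, hC.insert_of_covBy hcov, ?_, ?_⟩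
    · rw [hC.sum_insert hcov]
      simp only
      linarith
    · exact hb.imp (fun ⟨p, hp, e⟩ => ⟨p, Finset.mem_insert_of_mem hp, e⟩)
        fun ⟨p, hp, e⟩ => ⟨p, Finset.mem_insert_of_mem hp, e⟩

theorem exists_upperChain_step (hks : k ≤ s) {i j i' j' : ℕ} {w w' : ℝ}
    {hI' : (i', j') ∈ I r s k} {C : Finset (I r s k)} (hC : IsUpperChain ⟨(i', j'), hI'⟩ C)
    (hw : w ≤ ∑ p ∈ C, Y p.1.1 p.1.2) (hI : (i, j) ∈ I r s k)
    (hij : (i', j') = (i + 1, j) ∨ (i', j') = (i, j + 1)) (hw' : w' ≤ w + Y i j) :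
    IsUpperChain ⟨(i, j), hI⟩ (insert ⟨(i, j), hI⟩ C) ∧
      w' ≤ ∑ p ∈ insert ⟨(i, j), hI⟩ C, Y p.1.1 p.1.2 := by
  have hcov : (⟨(i, j), hI⟩ : I r s k) ⋖ ⟨(i', j'), hI'⟩ :=
    (I_isStepConnected hks).covBy_iff.2 hij
  refine ⟨hC.insert_of_covBy hcov.toDual, ?_⟩
  have h1 : ∑ p ∈ insert ⟨(i, j), hI⟩ C, Y p.1.1 p.1.2 = Y i j + ∑ p ∈ C, Y p.1.1 p.1.2 :=
    hC.sum_insert hcov.toDual fun p : (I r s k)ᵒᵈ => Y (OrderDual.ofDual p).1.1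
      (OrderDual.ofDual p).1.2
  linarith

theorem FreeSuffix.exists_chain (h : ShiftData r s k X F Y) {i j : ℕ} {w : ℝ}
    (hp : FreeSuffix r s k Y i j w) :
    ∃ (hI : (i, j) ∈ I r s k) (C : Finset (I r s k)),
      IsUpperChain ⟨(i, j), hI⟩ C ∧ w ≤ ∑ p ∈ C, Y p.1.1 p.1.2 := by
  classical
  have hks : k ≤ s := h.lt.le
  induction hp with
  | top h1 =>
    have hI := mem_I_iff.2 ((FreeSuffix.top h1).inI h)
    refine ⟨hI, {⟨_, hI⟩}, .singleton (P := (I r s k)ᵒᵈ) ?_, by simpa using h1⟩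
    exact IsMax.toDual fun q _ => le_top h.one_le hks h.le q
  | right h1 h2 h3 ih =>
    obtain ⟨hI, C, hC, hw⟩ := ih
    have hI' := mem_I_iff.2 h2
    exact ⟨hI', _, exists_upperChain_step hks hC hw hI' (Or.inl rfl) h3⟩
  | up h1 h2 h3 ih =>
    obtain ⟨hI, C, hC, hw⟩ := ih
    have hI' := mem_I_iff.2 h2
    exact ⟨hI', _, exists_upperChain_step hks hC hw hI' (Or.inr rfl) h3⟩

theorem PolySuffix.exists_chain (h : ShiftData r s k X F Y) {i j : ℕ} {w : ℝ}
    (hp : PolySuffix r s k Y i j w) :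
    ∃ (hI : (i, j) ∈ I r s k) (C : Finset (I r s k)),
      (IsUpperChain ⟨(i, j), hI⟩ C ∧ w ≤ ∑ p ∈ C, Y p.1.1 p.1.2) ∧
      ∃ p ∈ C, p.1.1 + 1 = p.1.2 + r := by
  classical
  have hks : k ≤ s := h.lt.le
  induction hp with
  | border h1 h2 h3 =>
    obtain ⟨hI, C, hC, hw⟩ := h1.exists_chain h
    exact ⟨hI, C, ⟨hC, hw⟩, _, hC.mem, by simp only; omega⟩
  | right h1 h2 h3 ih =>
    obtain ⟨hI, C, ⟨hC, hw⟩, p, hp, e⟩ := ih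
    have hI' := mem_I_iff.2 h2
    exact ⟨hI', _, exists_upperChain_step hks hC hw hI' (Or.inl rfl) h3, p,
      Finset.mem_insert_of_mem hp, e⟩
  | up h1 h2 h3 ih =>
    obtain ⟨hI, C, ⟨hC, hw⟩, p, hp, e⟩ := ih
    have hI' := mem_I_iff.2 h2
    exact ⟨hI', _, exists_upperChain_step hks hC hw hI' (Or.inr rfl) h3, p,
      Finset.mem_insert_of_mem hp, e⟩

open Classical in
-- Induction up the chain, keeping both kinds of prefix. The polygonal clause asks for a border
-- point strictly below p and for p off the border, because at a border point (i, j) the neighbour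
-- (i+1, j) leaves the grid.
theorem ShiftData.prefix_of_chain (h : ShiftData r s k X F Y) {C : Finset (I r s k)}
    (hC : IsMaxChain (· ≤ ·) (C : Set (I r s k))) (p : I r s k) (hp : p ∈ C) :
    (p.1.2 ≤ k → FreePrefix r s k X p.1.1 (p.1.2 + 1)
      ((∑ z ∈ C with z < p, Y z.1.1 z.1.2) - F p.1.1 p.1.2 + F p.1.1 (p.1.2 + 1))) ∧
    (((∃ z ∈ C, z < p ∧ z.1.1 + 1 = z.1.2 + r) ∨ ∃ z ∈ C, z.1 = (k, 1)) →
      p.1.1 + 1 < r + p.1.2 → PolyPrefix r s k X (p.1.1 + 1) p.1.2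
        ((∑ z ∈ C with z < p, Y z.1.1 z.1.2) - F p.1.1 p.1.2 + F (p.1.1 + 1) p.1.2)) := by
  have h0 := h.one_le
  have hlt := h.lt
  have hle := h.le
  have hks : k ≤ s := h.lt.le
  induction p using WellFoundedLT.induction with
  | ind p ih =>
    by_cases hm : IsMin p
    · rw [sum_filter_lt_of_isMin hm]
      have hadd := add_eq_of_isMin h.one_le hm
      have hI := mem_I_iff.1 p.2
      refine ⟨fun _ => h.freePrefix_start hI.1 hI.2.1 hadd, ?_⟩
      rintro (⟨z, -, hz, -⟩ | ⟨z, hz, hz1⟩) -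
      · exact absurd hz hm.not_lt
      · have hzp : z = p := by
          rcases hC.1.total hz hp with h' | h'
          · exact hm.eq_of_le h'
          · exact ((isMin_of_add_eq (by rw [hz1])).eq_of_le h').symm
        rw [← hzp, hz1]
        exact h.polyPrefix_start
    · obtain ⟨q, hq, hqp⟩ := exists_covBy_mem hC hp hm
      obtain ⟨ih0, ih1⟩ := ih q hqp.1 hq
      -- Unless q itself is on the border, a border point below p is already strictly below q and
      -- the induction hypothesis applies.
      have hpoly : ((∃ z ∈ C, z < p ∧ z.1.1 + 1 = z.1.2 + r) ∨ ∃ z ∈ C, z.1 = (k, 1)) →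
          q.1.1 + 1 ≠ q.1.2 + r →
          ((∃ z ∈ C, z < q ∧ z.1.1 + 1 = z.1.2 + r) ∨ ∃ z ∈ C, z.1 = (k, 1)) := by
        rintro (⟨z, hz, hzp, e⟩ | h') hqb
        · refine Or.inl ⟨z, hz, ?_, e⟩
          rcases hC.1.total hz hq with h' | h'
          · exact h'.lt_of_ne fun hzq => hqb (hzq ▸ e)
          · rcases h'.lt_or_eq with h' | h'
            · exact absurd hzp (hqp.2 h')
            · exact absurd (h' ▸ e) hqb
        · exact Or.inr h'
      rw [sum_filter_lt_of_covBy hC.1 hq hqp]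
      obtain ⟨⟨i, j⟩, hqI⟩ := q
      obtain ⟨⟨i', j'⟩, hpI⟩ := p
      have hIq := mem_I_iff.1 hqI
      have hIp := mem_I_iff.1 hpI
      have hcov := (I_isStepConnected hks).covBy_iff.1 hqp
      simp only [Prod.mk.injEq] at hcov ih0 ih1 hpoly ⊢
      rcases hcov with ⟨rfl, rfl⟩ | ⟨rfl, rfl⟩
      · refine ⟨fun hj => h.freePrefix_right hIq hj hIp (ih0 hj), fun hz hb => ?_⟩
        exact h.polyPrefix_right hIq hIp (by omega)
          (ih1 (hpoly hz (by unfold InI at *; omega)) (by omega))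
      · refine ⟨fun hj => h.freePrefix_up hIq hj (ih0 (by omega)), fun hz hb => ?_⟩
        by_cases hqb : i' + 1 = j + r
        · have hj : j ≤ k := by unfold InI at *; omega
          exact h.polyPrefix_border hIq hj (by omega) (ih0 hj)
        · exact h.polyPrefix_up hIq hIp (ih1 (hpoly hz hqb) (by unfold InI at *; omega))

/-- Bounds on polygonal chains are transported from `I r s (k + 1)` to `I r s k`. -/
theorem ShiftData.sum_le (h : ShiftData r s k X F Y) {l : ℝ}
    (hx : ∀ C : Finset (I r s (k + 1)), IsPolygonal C → ∑ p ∈ C, X p.1.1 p.1.2 ≤ l)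
    {C : Finset (I r s k)} (hC : IsPolygonal C) : ∑ p ∈ C, Y p.1.1 p.1.2 ≤ l := by
  classical
  have h0 := h.one_le
  have hlt := h.lt
  have hle := h.le
  have hks : k ≤ s := h.lt.le
  have hIt : (r + k - 1, s) ∈ I r s k := mem_I_iff.2 (by unfold InI; omega)
  have htop : ∀ p : I r s k, p ≤ ⟨(r + k - 1, s), hIt⟩ := le_top h.one_le hks h.le
  have hmem : (⟨(r + k - 1, s), hIt⟩ : I r s k) ∈ (C : Set (I r s k)) :=
    mem_of_forall_comparable hC.1 fun c _ => Or.inl (htop c)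
  -- As k < s, the maximum of I_k is off the border, so any border point of C lies strictly below
  -- it.
  have hp := (h.prefix_of_chain hC.1 _ hmem).2 ?_ (by simp only; omega)
  · simp only [show r + k - 1 + 1 = r + k by omega] at hp
    obtain ⟨hI, D, hD, hw, hpol⟩ := (h.polyPrefix_end hp).exists_chain h
    rw [sum_eq_sum_lt_add_sum_gt hC.1.1 hmem,
      sum_filter_gt_of_isMax (IsTop.isMax htop), add_zero]
    refine hw.trans (hx D ⟨hD.isMaxChain ?_, hpol⟩)
    exact le_top (by omega) h.lt h.le
  · rcases hC.2 with ⟨z, hz, e⟩ | h'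
    · refine Or.inl ⟨z, hz, (htop z).lt_of_ne fun hzt => ?_, e⟩
      rw [hzt] at e
      simp only at e
      omega
    · exact Or.inr h'

open Classical in
-- Induction down the chain. The free suffix needs no border point; the polygonal one becomes
-- available once the border has been met strictly above p.
theorem ShiftData.suffix_of_chain (h : ShiftData r s k X F Y) {C : Finset (I r s (k + 1))}
    (hC : IsMaxChain (· ≤ ·) (C : Set (I r s (k + 1)))) (p : I r s (k + 1)) (hp : p ∈ C) :
    (∀ i, p.1.1 = i + 1 → k ≤ i → FreeSuffix r s k Y i p.1.2
      ((∑ z ∈ C with p < z, X z.1.1 z.1.2) + F (i + 1) p.1.2 - F i p.1.2)) ∧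
    ((∃ z ∈ C, p < z ∧ z.1.1 + 1 = z.1.2 + r) → p.1.1 + 1 < r + p.1.2 →
      ∀ j, p.1.2 = j + 1 → 1 ≤ j → PolySuffix r s k Y p.1.1 j
        ((∑ z ∈ C with p < z, X z.1.1 z.1.2) + F p.1.1 (j + 1) - F p.1.1 j)) := by
  have h0 := h.one_le
  have hlt := h.lt
  have hle := h.le
  have hks : k + 1 ≤ s := h.lt
  induction p using WellFoundedGT.induction with
  | ind p ih =>
    by_cases hm : IsMax p
    · rw [sum_filter_gt_of_isMax hm]
      refine ⟨fun i hi hki => ?_, fun ⟨z, _, hz, _⟩ => absurd hz hm.not_lt⟩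
      have hpt := hm.eq_of_le (le_top (by omega) hks hle p)
      have h1 : p.1.1 = r + k := by rw [hpt]; simp only; omega
      have h2 : p.1.2 = s := by rw [hpt]
      have h3 : i = r + k - 1 := by omega
      subst h3
      rw [h2, show r + k - 1 + 1 = r + k by omega]
      exact h.freeSuffix_top
    · obtain ⟨q, hq, hpq⟩ := exists_covBy_mem_of_not_isMax hC hp hm
      obtain ⟨ih1, ih0⟩ := ih q hpq.1 hq
      have hpoly : (∃ z ∈ C, p < z ∧ z.1.1 + 1 = z.1.2 + r) → q.1.1 + 1 ≠ q.1.2 + r →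
          ∃ z ∈ C, q < z ∧ z.1.1 + 1 = z.1.2 + r := by
        rintro ⟨z, hz, hpz, e⟩ hqb
        refine ⟨z, hz, ?_, e⟩
        rcases hC.1.total hq hz with h' | h'
        · exact h'.lt_of_ne fun hzq => hqb (hzq ▸ e)
        · rcases h'.lt_or_eq with h' | h'
          · exact absurd h' (hpq.2 hpz)
          · exact absurd (h' ▸ e) hqb
      -- Border points of I_{k+1} lie in rows up to k + 1, hence so does the chain below one; there
      -- the suffix has room one row lower.
      have hrow : (∃ z ∈ C, p < z ∧ z.1.1 + 1 = z.1.2 + r) → q.1.2 ≤ k + 1 := by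
        rintro ⟨z, hz, hpz, e⟩
        have hqz : q ≤ z := by
          rcases hC.1.total hq hz with h' | h'
          · exact h'
          · rcases h'.lt_or_eq with h' | h'
            · exact absurd h' (hpq.2 hpz)
            · exact h'.ge
        have hzI : InI r s (k + 1) z.1.1 z.1.2 := mem_I_iff.1 z.2
        have hqz' : q.1.2 ≤ z.1.2 := (Prod.mk_le_mk.1 hqz).2
        unfold InI at hzI
        omega
      rw [sum_filter_gt_of_covBy hC.1 hq hpq]
      obtain ⟨⟨a, b⟩, hpI⟩ := p
      obtain ⟨⟨a', b'⟩, hqI⟩ := q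
      have hIq := mem_I_iff.1 hqI
      have hIp := mem_I_iff.1 hpI
      have hcov := (I_isStepConnected hks).covBy_iff.1 hpq
      simp only [Prod.mk.injEq] at hcov ih0 ih1 hpoly hrow ⊢
      rcases hcov with ⟨rfl, rfl⟩ | ⟨rfl, rfl⟩
      · constructor
        · rintro i rfl hi
          exact h.freeSuffix_right hi (by unfold InI at *; omega) (ih1 (i + 1) rfl (by omega)) hIq
        · rintro hz hb j rfl hj
          have hrow := hrow hz
          have hI' : InI r s k a j := by unfold InI at *; omega
          by_cases hqb : a + 1 + 1 = j + 1 + r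
          · exact h.polySuffix_border hI' (by omega) (by omega) (ih1 a rfl (by omega))
          · exact h.polySuffix_right hI'
              (ih0 (hpoly hz hqb) (by unfold InI at *; omega) j rfl hj)
      · constructor
        · rintro i rfl hi
          exact h.freeSuffix_up (by unfold InI at *; omega) (ih1 i rfl hi) hIp
        · rintro hz hb j rfl hj
          have hrow := hrow hz
          exact h.polySuffix_up (by unfold InI at *; omega)
            (ih0 (hpoly hz (by unfold InI at *; omega)) (by omega) (j + 1) rfl (by omega))

/-- Bounds on polygonal chains are transported from `I r s k` to `I r s (k + 1)`. -/
theorem ShiftData.sum_le' (h : ShiftData r s k X F Y) {l : ℝ}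
    (hy : ∀ C : Finset (I r s k), IsPolygonal C → ∑ p ∈ C, Y p.1.1 p.1.2 ≤ l)
    {C : Finset (I r s (k + 1))} (hC : IsPolygonal C) : ∑ p ∈ C, X p.1.1 p.1.2 ≤ l := by
  classical
  have h0 := h.one_le
  have hlt := h.lt
  have hle := h.le
  have hks : k + 1 ≤ s := h.lt
  have hupper : ∀ {p : I r s k} {D : Finset (I r s k)}, IsUpperChain p D → IsMin p →
      IsMaxChain (· ≤ ·) (D : Set (I r s k)) := by
    intro p D hD hp
    have := (IsLowerChain.singleton hp).isMaxChain_union hD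
    have hu : ({p} ∪ D : Finset (I r s k)) = D :=
      Finset.union_eq_right.2 (Finset.singleton_subset_iff.2 hD.mem)
    rwa [← hu]
  have hne : C.Nonempty := by
    rcases hC.2 with ⟨z, hz, -⟩ | ⟨z, hz, -⟩ <;> exact ⟨z, hz⟩
  obtain ⟨p, hpm⟩ := Finset.exists_minimal hne
  have hp := hpm.prop
  have hmin : IsMin p := by
    by_contra hm
    obtain ⟨q, hq, hqp⟩ := exists_covBy_mem hC.1 hp hm
    exact (hpm.le_of_le hq hqp.1.le).not_gt hqp.1
  have hpl : ∀ z ∈ C, p ≤ z := fun z hz => by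
    rcases hC.1.1.total hp hz with h' | h'
    · exact h'
    · exact hpm.le_of_le hz h'
  obtain ⟨h1, h2⟩ := h.suffix_of_chain hC.1 p hp
  rw [sum_eq_sum_lt_add_sum_gt hC.1.1 hp, sum_filter_lt_of_isMin hmin, zero_add, add_comm]
  have hadd := add_eq_of_isMin (by omega) hmin
  obtain ⟨⟨a, b⟩, hpI⟩ := p
  have hIp := mem_I_iff.1 hpI
  simp only at h1 h2 hadd ⊢
  -- A chain starting in row 1 starts at (k+1, 1), and any suffix from (k, 1) is polygonal.
  -- Otherwise (k+1, 1) is not above the start, so the chain must meet the border, and it does so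
  -- strictly above its start.
  by_cases hb : b = 1
  · subst hb
    obtain rfl : a = k + 1 := by omega
    obtain ⟨hI, D, hD, hw⟩ := (h.freeSuffix_end (h1 k rfl le_rfl)).exists_chain h
    exact hw.trans (hy D ⟨hupper hD (isMin_of_add_eq rfl), Or.inr ⟨_, hD.mem, rfl⟩⟩)
  · obtain ⟨j, rfl⟩ : ∃ j, b = j + 1 := ⟨b - 1, by unfold InI at *; omega⟩
    have hj : j ≤ k := by unfold InI at *; omega
    have hpoly : ∃ z ∈ C, (⟨(a, j + 1), hpI⟩ : I r s (k + 1)) < z ∧ z.1.1 + 1 = z.1.2 + r := by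
      rcases hC.2 with ⟨z, hz, e⟩ | ⟨z, hz, e⟩
      · refine ⟨z, hz, (hpl z hz).lt_of_ne fun hzp => ?_, e⟩
        rw [← hzp] at e
        simp only at e
        unfold InI at hIp
        omega
      · have hle := hpl z hz
        have hle : (a, j + 1) ≤ z.1 := hle
        rw [e, Prod.mk_le_mk] at hle
        omega
    have hI' : InI r s k a j := by unfold InI at *; omega
    have hps := h2 hpoly (by unfold InI at *; omega) j rfl (by omega)
    obtain ⟨hI, D, ⟨hD, hw⟩, hbord⟩ := (h.polySuffix_end hI' hj hps).exists_chain h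
    exact hw.trans (hy D ⟨hupper hD (isMin_of_add_eq (by simp only; omega)), Or.inl hbord⟩)

end GridPoset

/-! ### The map `zeta` -/

section Lattice

variable {P : Type} [PartialOrder P] [Fintype P]

theorem IsLowerPotential.mem_lattice_iff {x F : P → ℝ} (h : IsLowerPotential x F) :
    x ∈ lattice P ↔ F ∈ lattice P := by
  constructor
  · intro hx p
    induction p using WellFoundedLT.induction with
    | ind p ih =>
      obtain ⟨n, hn⟩ := hx p
      by_cases hm : IsMin p
      · exact ⟨n, by rw [h.of_isMin p hm, hn]⟩
      · obtain ⟨q, hqp, e⟩ := h.exists_eq p hm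
        obtain ⟨m, hm⟩ := ih q hqp.1
        exact ⟨n + m, by rw [e, hn, hm]; push_cast; ring⟩
  · intro hF p
    obtain ⟨n, hn⟩ := hF p
    by_cases hm : IsMin p
    · exact ⟨n, by rw [← h.of_isMin p hm, hn]⟩
    · obtain ⟨q, -, e⟩ := h.exists_eq p hm
      obtain ⟨m, hm⟩ := hF q
      exact ⟨n - m, by push_cast; linarith⟩

theorem IsUpperPotential.mem_lattice_iff {y F : P → ℝ} (h : IsUpperPotential y F) :
    y ∈ lattice P ↔ F ∈ lattice P := by
  refine h.dual.mem_lattice_iff.trans ⟨fun hF p => ?_, fun hF p => ?_⟩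
  · obtain ⟨n, hn⟩ := hF p
    exact ⟨-n, by push_cast; linarith⟩
  · obtain ⟨n, hn⟩ := hF p
    exact ⟨-n, by push_cast; linarith⟩

theorem rowmotion_symm_mem_lattice_iff (L : LinExt P) (x : P → ℝ) :
    (rowmotion L).symm x ∈ lattice P ↔ x ∈ lattice P := by
  obtain ⟨F, hF⟩ := exists_isLowerPotential x
  obtain ⟨y, hy⟩ := exists_isUpperPotential F
  rw [rowmotion_symm_eq L hF hy, hy.mem_lattice_iff, hF.mem_lattice_iff]

end Lattice

/-! ### The interval M_k and the common potential of x and ζ_k(x) -/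

section Interval

variable {r s k : ℕ}

/-- Membership in `M r s k`, in coordinates. -/
def InM (r k i j : ℕ) : Prop := k ≤ i ∧ 1 ≤ j ∧ j ≤ k + 1 ∧ i < r + j

theorem mem_M_iff (hk1 : 1 ≤ k) (hk : k < s) {i j : ℕ} : (i, j) ∈ M r s k ↔ InM r k i j := by
  simp only [M, RT, InM, Finset.mem_filter, Finset.mem_product, Finset.mem_Icc, Prod.mk_le_mk]
  omega

theorem M_isStepConnected (hk1 : 1 ≤ k) (hk : k < s) : IsStepConnected (M r s k) := by
  rintro ⟨i, j⟩ hp ⟨i', j'⟩ hq h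
  rw [mem_M_iff hk1 hk] at hp hq ⊢
  rw [Prod.mk_lt_mk] at h
  rw [mem_M_iff hk1 hk]
  simp only [Prod.mk_le_mk]
  unfold InM at *
  omega

theorem M_isMin_iff (hk1 : 1 ≤ k) (hk : k < s) (hsr : s ≤ r) {p : M r s k} :
    IsMin p ↔ p.1 = (k, 1) := by
  have hm : (k, 1) ∈ M r s k := (mem_M_iff hk1 hk).2 (by unfold InM; omega)
  have hbot : ∀ q : M r s k, (⟨(k, 1), hm⟩ : M r s k) ≤ q := by
    rintro ⟨⟨i, j⟩, hq⟩
    have := (mem_M_iff hk1 hk).1 hq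
    exact Prod.mk_le_mk.2 ⟨this.1, this.2.1⟩
  constructor
  · intro h
    rw [← h.eq_of_le (hbot p)]
  · intro h q _
    have : p = ⟨(k, 1), hm⟩ := Subtype.ext h
    exact this ▸ hbot q

theorem M_isMax_iff (hk1 : 1 ≤ k) (hk : k < s) {p : M r s k} :
    IsMax p ↔ p.1 = (r + k, k + 1) := by
  have hm : (r + k, k + 1) ∈ M r s k := (mem_M_iff hk1 hk).2 (by unfold InM; omega)
  have htop : ∀ q : M r s k, q ≤ (⟨(r + k, k + 1), hm⟩ : M r s k) := by
    rintro ⟨⟨i, j⟩, hq⟩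
    have := (mem_M_iff hk1 hk).1 hq
    exact Prod.mk_le_mk.2 (by unfold InM at this; omega)
  constructor
  · intro h
    rw [h.eq_of_le (htop p)]
  · intro h q _
    have : p = ⟨(r + k, k + 1), hm⟩ := Subtype.ext h
    exact this ▸ htop q

theorem inI_of_inM (hk1 : 1 ≤ k) (hk : k < s) {i j : ℕ} (h : InM r k i j)
    (hne : (i, j) ≠ (r + k, k + 1)) : InI r s k i j := by
  simp only [ne_eq, Prod.mk.injEq] at hne
  unfold InM at h
  unfold InI
  omega

/-- Extension of a labeling of `S` by zero. -/
def gridExtend {S : Finset (ℕ × ℕ)} (f : S → ℝ) (i j : ℕ) : ℝ :=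
  if h : (i, j) ∈ S then f ⟨(i, j), h⟩ else 0

theorem gridExtend_of_mem {S : Finset (ℕ × ℕ)} (f : S → ℝ) {i j : ℕ} (h : (i, j) ∈ S) :
    gridExtend f i j = f ⟨(i, j), h⟩ := dif_pos h

theorem gridExtend_coe {S : Finset (ℕ × ℕ)} (f : S → ℝ) (p : S) :
    gridExtend f p.1.1 p.1.2 = f p := dif_pos p.2

theorem extendLabel_eq_gridExtend (a : ℝ) (x : I r s (k + 1) → ℝ) {i j : ℕ}
    (h : (i, j) ∈ M r s k) (hne : (i, j) ≠ (k, 1)) :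
    extendLabel a x ⟨(i, j), h⟩ = gridExtend x i j := by
  rw [extendLabel, dif_neg hne, gridExtend_of_mem x (mem_I_succ_of_mem_M h hne)]

theorem zeta_of_mem {hk : k < s} {L : LinExt (M r s k)} {a : ℝ} {x : I r s (k + 1) → ℝ} {i j : ℕ}
    (hI : (i, j) ∈ I r s k) (hM : (i, j) ∈ M r s k) :
    zeta hk L a x ⟨(i, j), hI⟩ = (rowmotion L).symm (extendLabel a x) ⟨(i, j), hM⟩ :=
  dif_pos hM

theorem zeta_above (hk1 : 1 ≤ k) {hk : k < s} {L : LinExt (M r s k)} {a : ℝ}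
    {x : I r s (k + 1) → ℝ} {i j : ℕ} (hI : (i, j) ∈ I r s k) (hj : k + 1 < j) :
    zeta hk L a x ⟨(i, j), hI⟩ = gridExtend x (i + 1) j := by
  have hM : (i, j) ∉ M r s k := fun h => by
    have := (mem_M_iff hk1 hk).1 h
    unfold InM at this
    omega
  rw [zeta, dif_neg hM, dif_pos hj, gridExtend_of_mem x (mem_I_succ_of_above hk hI hj)]

theorem zeta_below (hk1 : 1 ≤ k) {hk : k < s} {L : LinExt (M r s k)} {a : ℝ}
    {x : I r s (k + 1) → ℝ} {i j : ℕ} (hI : (i, j) ∈ I r s k) (hi : i < k) :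
    zeta hk L a x ⟨(i, j), hI⟩ = gridExtend x i (j + 1) := by
  have hM : (i, j) ∉ M r s k := fun h => by
    have := (mem_M_iff hk1 hk).1 h
    unfold InM at this
    omega
  have hj := (below_iff hI hM).2 hi
  rw [zeta, dif_neg hM, dif_neg hj, gridExtend_of_mem x (mem_I_succ_of_below hk hI hM hj)]

theorem lowerPotential_coordinates (hk1 : 1 ≤ k) (hk : k < s) (hsr : s ≤ r) {a : ℝ}
    {x : I r s (k + 1) → ℝ} {F : M r s k → ℝ} (hF : IsLowerPotential (extendLabel a x) F) :
    (∀ i j, InM r k i j → InM r k (i + 1) j →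
      gridExtend x (i + 1) j + gridExtend F i j ≤ gridExtend F (i + 1) j) ∧
    (∀ i j, InM r k i j → InM r k i (j + 1) →
      gridExtend x i (j + 1) + gridExtend F i j ≤ gridExtend F i (j + 1)) ∧
    (∀ i j, InM r k i j → (i, j) ≠ (k, 1) →
      (∃ i', i = i' + 1 ∧ InM r k i' j ∧
        gridExtend F i j = gridExtend x i j + gridExtend F i' j) ∨
      (∃ j', j = j' + 1 ∧ InM r k i j' ∧
        gridExtend F i j = gridExtend x i j + gridExtend F i j')) := by
  have hS := M_isStepConnected (r := r) hk1 hk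
  refine ⟨fun i j h1 h2 => ?_, fun i j h1 h2 => ?_, fun i j h1 hne => ?_⟩
  · rw [← mem_M_iff hk1 hk] at h1 h2
    have hne : (i + 1, j) ≠ (k, 1) := by
      have := (mem_M_iff hk1 hk).1 h1
      unfold InM at this
      simp only [ne_eq, Prod.mk.injEq]
      omega
    have := hF.le_of_covBy ⟨_, h2⟩ ⟨_, h1⟩ (hS.covBy_iff.2 (Or.inl rfl))
    rwa [extendLabel_eq_gridExtend a x h2 hne, ← gridExtend_of_mem F h1,
      ← gridExtend_of_mem F h2] at this
  · rw [← mem_M_iff hk1 hk] at h1 h2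
    have hne : (i, j + 1) ≠ (k, 1) := by
      have := (mem_M_iff hk1 hk).1 h1
      unfold InM at this
      simp only [ne_eq, Prod.mk.injEq]
      omega
    have := hF.le_of_covBy ⟨_, h2⟩ ⟨_, h1⟩ (hS.covBy_iff.2 (Or.inr rfl))
    rwa [extendLabel_eq_gridExtend a x h2 hne, ← gridExtend_of_mem F h1,
      ← gridExtend_of_mem F h2] at this
  · rw [← mem_M_iff hk1 hk] at h1
    have hnm : ¬ IsMin (⟨(i, j), h1⟩ : M r s k) := fun h => hne ((M_isMin_iff hk1 hk hsr).1 h)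
    obtain ⟨⟨⟨i', j'⟩, hq⟩, hcov, e⟩ := hF.exists_eq _ hnm
    rw [extendLabel_eq_gridExtend a x h1 hne, ← gridExtend_of_mem F h1,
      ← gridExtend_of_mem F hq] at e
    rcases hS.covBy_iff.1 hcov with h | h <;> simp only [Prod.mk.injEq] at h <;>
      obtain ⟨rfl, rfl⟩ := h
    · exact Or.inl ⟨_, rfl, (mem_M_iff hk1 hk).1 hq, e⟩
    · exact Or.inr ⟨_, rfl, (mem_M_iff hk1 hk).1 hq, e⟩

theorem upperPotential_coordinates (hk1 : 1 ≤ k) (hk : k < s)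
    {y F : M r s k → ℝ} (hF : IsUpperPotential y F) :
    (∀ i j, InM r k i j → InM r k (i + 1) j →
      gridExtend y i j + gridExtend F i j ≤ gridExtend F (i + 1) j) ∧
    (∀ i j, InM r k i j → InM r k i (j + 1) →
      gridExtend y i j + gridExtend F i j ≤ gridExtend F i (j + 1)) ∧
    (∀ i j, InM r k i j → (i, j) ≠ (r + k, k + 1) →
      (InM r k (i + 1) j ∧ gridExtend y i j + gridExtend F i j = gridExtend F (i + 1) j) ∨
      (InM r k i (j + 1) ∧ gridExtend y i j + gridExtend F i j = gridExtend F i (j + 1))) := by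
  have hS := M_isStepConnected (r := r) hk1 hk
  refine ⟨fun i j h1 h2 => ?_, fun i j h1 h2 => ?_, fun i j h1 hne => ?_⟩
  · rw [← mem_M_iff hk1 hk] at h1 h2
    have := hF.le_of_covBy ⟨_, h1⟩ ⟨_, h2⟩ (hS.covBy_iff.2 (Or.inl rfl))
    rwa [← gridExtend_of_mem y h1, ← gridExtend_of_mem F h1, ← gridExtend_of_mem F h2] at this
  · rw [← mem_M_iff hk1 hk] at h1 h2
    have := hF.le_of_covBy ⟨_, h1⟩ ⟨_, h2⟩ (hS.covBy_iff.2 (Or.inr rfl))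
    rwa [← gridExtend_of_mem y h1, ← gridExtend_of_mem F h1, ← gridExtend_of_mem F h2] at this
  · rw [← mem_M_iff hk1 hk] at h1
    have hnm : ¬ IsMax (⟨(i, j), h1⟩ : M r s k) := fun h => hne ((M_isMax_iff hk1 hk).1 h)
    obtain ⟨⟨⟨i', j'⟩, hq⟩, hcov, e⟩ := hF.exists_eq _ hnm
    rw [← gridExtend_of_mem y h1, ← gridExtend_of_mem F h1, ← gridExtend_of_mem F hq] at e
    rcases hS.covBy_iff.1 hcov with h | h <;> simp only [Prod.mk.injEq] at h <;>
      obtain ⟨rfl, rfl⟩ := h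
    · exact Or.inl ⟨(mem_M_iff hk1 hk).1 hq, e⟩
    · exact Or.inr ⟨(mem_M_iff hk1 hk).1 hq, e⟩

theorem exists_shiftData (hk1 : 1 ≤ k) (hk : k < s) (hsr : s ≤ r) (L : LinExt (M r s k)) (a : ℝ)
    (x : I r s (k + 1) → ℝ) :
    ∃ F, ShiftData r s k (gridExtend x) F (gridExtend (zeta hk L a x)) := by
  obtain ⟨G, hG⟩ := exists_isLowerPotential (extendLabel a x : M r s k → ℝ)
  obtain ⟨y, hy⟩ := exists_isUpperPotential G
  have hrow := rowmotion_symm_eq L hG hy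
  obtain ⟨g1, g2, g3⟩ := lowerPotential_coordinates hk1 hk hsr hG
  obtain ⟨u1, u2, u3⟩ := upperPotential_coordinates hk1 hk hy
  have hY : ∀ i j, InM r k i j → (i, j) ≠ (r + k, k + 1) →
      gridExtend (zeta hk L a x) i j = gridExtend y i j := by
    intro i j h hne
    have hI := mem_I_iff.2 (inI_of_inM hk1 hk h hne)
    have hM := (mem_M_iff hk1 hk).2 h
    rw [gridExtend_of_mem _ hI, gridExtend_of_mem _ hM, zeta_of_mem hI hM, hrow]
  have hYb : ∀ i j, InI r s k i j → i < k →
      gridExtend (zeta hk L a x) i j = gridExtend x i (j + 1) := by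
    intro i j h hi
    have hI := mem_I_iff.2 h
    rw [gridExtend_of_mem _ hI, zeta_below hk1 hI hi]
  have hYa : ∀ i j, InI r s k i j → k + 1 < j →
      gridExtend (zeta hk L a x) i j = gridExtend x (i + 1) j := by
    intro i j h hj
    have hI := mem_I_iff.2 h
    rw [gridExtend_of_mem _ hI, zeta_above hk1 hI hj]
  -- On M_k the potential is that of rowmotion. Below M_k it is a partial sum up each column, above
  -- M_k along each row, so that the shifts become differences. The conditions compare values there
  -- only within one column or one row, so each may be normalized separately.
  refine ⟨fun i j => if i < k then ∑ t ∈ Finset.Ioc (k + 1 - i) j, gridExtend x i t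
    else if k + 1 < j then ∑ t ∈ Finset.Ioc k i, gridExtend x t j else gridExtend G i j,
    hk1, hk, hsr, ?_, ?_, ?_, ?_, ?_, ?_⟩
  · intro i j hi1 hik hjk hij
    rcases hik.lt_or_eq with hik | rfl
    · simp only [if_pos hik]
      rw [Finset.sum_Ioc_succ_top (by omega)]
      ring
    · simp only [lt_irrefl, if_false, if_neg (show ¬ i + 1 < j + 1 by omega),
        if_neg (show ¬ i + 1 < j by omega)]
      rcases g3 i (j + 1) (by unfold InM; omega) (by simp only [ne_eq, Prod.mk.injEq]; omega)
        with ⟨i', h1, h2, h3⟩ | ⟨j', h1, h2, h3⟩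
      · unfold InM at h2; omega
      · obtain rfl : j = j' := by omega
        linarith
  · intro i j hki hc
    simp only [if_neg (show ¬ i < k by omega), if_neg (show ¬ i + 1 < k by omega)]
    by_cases hj : k + 1 < j
    · simp only [if_pos hj]
      rw [Finset.sum_Ioc_succ_top (by omega)]
      ring
    · simp only [if_neg hj]
      rcases g3 (i + 1) j (by unfold InM; omega) (by simp only [ne_eq, Prod.mk.injEq]; omega)
        with ⟨i', h1, h2, h3⟩ | ⟨j', h1, h2, h3⟩
      · obtain rfl : i = i' := by omega
        linarith
      · unfold InM at h2; omega
  · intro i j hki hj hjk hb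
    simp only [if_neg (show ¬ i < k by omega), if_neg (show ¬ i + 1 < k by omega),
      if_neg (show ¬ k + 1 < j by omega), if_neg (show ¬ k + 1 < j + 1 by omega)]
    have e1 := g1 i (j + 1) (by unfold InM; omega) (by unfold InM; omega)
    have e2 := g2 (i + 1) j (by unfold InM; omega) (by unfold InM; omega)
    rcases g3 (i + 1) (j + 1) (by unfold InM; omega) (by simp only [ne_eq, Prod.mk.injEq]; omega)
      with ⟨i', h1, h2, h3⟩ | ⟨j', h1, h2, h3⟩
    · obtain rfl : i = i' := by omega
      rw [max_eq_left (by linarith)]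
      linarith
    · obtain rfl : j = j' := by omega
      rw [max_eq_right (by linarith)]
      linarith
  · intro i j hi hj hjk hc
    rcases hc with ⟨hik, hij⟩ | hb
    · simp only [if_pos hik]
      rw [hYb i j (by unfold InI; omega) hik, Finset.sum_Ioc_succ_top (by omega)]
      ring
    · simp only [if_neg (show ¬ i < k by omega), if_neg (show ¬ k + 1 < j by omega),
        if_neg (show ¬ k + 1 < j + 1 by omega)]
      have hne : (i, j) ≠ (r + k, k + 1) := by simp only [ne_eq, Prod.mk.injEq]; omega
      rw [hY i j (by unfold InM; omega) hne]
      rcases u3 i j (by unfold InM; omega) hne with ⟨h1, h2⟩ | ⟨h1, h2⟩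
      · unfold InM at h1; omega
      · linarith
  · intro i j hki hir hkj hjs
    simp only [if_neg (show ¬ i < k by omega), if_neg (show ¬ i + 1 < k by omega)]
    by_cases hj : k + 1 < j
    · simp only [if_pos hj]
      rw [hYa i j (by unfold InI; omega) hj, Finset.sum_Ioc_succ_top (by omega)]
      ring
    · simp only [if_neg hj]
      have hne : (i, j) ≠ (r + k, k + 1) := by simp only [ne_eq, Prod.mk.injEq]; omega
      rw [hY i j (by unfold InM; omega) hne]
      rcases u3 i j (by unfold InM; omega) hne with ⟨h1, h2⟩ | ⟨h1, h2⟩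
      · linarith
      · unfold InM at h1; omega
  · intro i j hki hj hjk hb
    simp only [if_neg (show ¬ i < k by omega), if_neg (show ¬ i + 1 < k by omega),
      if_neg (show ¬ k + 1 < j by omega), if_neg (show ¬ k + 1 < j + 1 by omega)]
    have hne : (i, j) ≠ (r + k, k + 1) := by simp only [ne_eq, Prod.mk.injEq]; omega
    rw [hY i j (by unfold InM; omega) hne]
    have e1 := u1 i j (by unfold InM; omega) (by unfold InM; omega)
    have e2 := u2 i j (by unfold InM; omega) (by unfold InM; omega)
    rcases u3 i j (by unfold InM; omega) hne with ⟨h1, h2⟩ | ⟨h1, h2⟩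
    · rw [min_eq_left (by linarith)]
      linarith
    · rw [min_eq_right (by linarith)]
      linarith

/-- The labels X are lower bounds for unit increments of F, and each Y is such an increment or the
smaller of two. -/
theorem ShiftData.y_nonneg {X F Y : ℕ → ℕ → ℝ} (h : ShiftData r s k X F Y)
    (hX : ∀ i j, InI r s (k + 1) i j → 0 ≤ X i j) {i j : ℕ} (hI : InI r s k i j) : 0 ≤ Y i j := by
  have h0 := h.one_le
  have hlt := h.lt
  have hle := h.le
  have hup : j ≤ k → 0 ≤ F i (j + 1) - F i j := fun hj =>
    (hX i (j + 1) (by unfold InI at *; omega)).trans (h.x_le_up hI hj)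
  have hright : k ≤ i → (k < j ∨ i + 1 < r + j) → 0 ≤ F (i + 1) j - F i j := fun hi hj =>
    (hX (i + 1) j (by unfold InI at *; omega)).trans (h.x_le_right hI hi hj)
  obtain ⟨h1, h2, h3, h4, h5⟩ := hI
  by_cases hj : k < j
  · rw [h.y_right i j (by omega) (by omega) hj h3]
    exact hright (by omega) (by omega)
  · by_cases hc : (i < k ∧ k < i + j) ∨ i + 1 = r + j
    · rw [h.y_up i j h1 h2 (by omega) hc]
      exact hup (by omega)
    · rw [h.y_min i j (by omega) h2 (by omega) (by omega)]
      have e1 := hup (by omega)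
      have e2 := hright (by omega) (by omega)
      rw [sub_nonneg]
      exact le_min (by linarith) (by linarith)

theorem ShiftData.x_nonneg {X F Y : ℕ → ℕ → ℝ} (h : ShiftData r s k X F Y)
    (hY : ∀ i j, InI r s k i j → 0 ≤ Y i j) {i j : ℕ} (hI : InI r s (k + 1) i j) : 0 ≤ X i j := by
  have h0 := h.one_le
  have hlt := h.lt
  have hle := h.le
  have hup : ∀ i j, InI r s k i j → j ≤ k → 0 ≤ F i (j + 1) - F i j := fun i j hI hj =>
    (hY i j hI).trans (h.y_le_up hI hj)
  have hright : ∀ i j, InI r s k i j → k ≤ i → (k < j ∨ i + 1 < r + j) →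
      0 ≤ F (i + 1) j - F i j := fun i j hI hi hj => (hY i j hI).trans (h.y_le_right hI hi hj)
  by_cases hi : i ≤ k
  · obtain ⟨j, rfl⟩ : ∃ j', j = j' + 1 := ⟨j - 1, by unfold InI at hI; omega⟩
    unfold InI at hI
    rw [h.x_up i j hI.1 hi (by omega) (by omega)]
    exact hup i j (by unfold InI; omega) (by omega)
  · obtain ⟨i, rfl⟩ : ∃ i', i = i' + 1 := ⟨i - 1, by omega⟩
    by_cases hc : (j = 1 ∧ i + 1 ≤ r) ∨ (2 ≤ j ∧ j ≤ k + 1 ∧ i + 2 = r + j) ∨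
      (k + 2 ≤ j ∧ j ≤ s ∧ i + 1 ≤ r + k)
    · rw [h.x_right i j (by omega) hc]
      exact hright i j (by unfold InI at *; omega) (by omega) (by unfold InI at *; omega)
    · obtain ⟨j, rfl⟩ : ∃ j', j = j' + 1 := ⟨j - 1, by unfold InI at hI; omega⟩
      unfold InI at hI
      rw [h.x_max i j (by omega) (by omega) (by omega) (by omega)]
      have e1 := hup (i + 1) j (by unfold InI; omega) (by omega)
      have e2 := hright i (j + 1) (by unfold InI; omega) (by omega) (by omega)
      rw [sub_nonneg]
      exact max_le (by linarith) (by linarith)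

/-- The `l`-th dilate of the polygonal chain polytope, by inequalities. -/
def dilatedPolytope (r s k : ℕ) (l : ℝ) : Set (I r s k → ℝ) :=
  {x | (∀ p, 0 ≤ x p) ∧ ∀ C : Finset (I r s k), IsPolygonal C → ∑ p ∈ C, x p ≤ l}

theorem zeta_mem_dilatedPolytope_iff (hk1 : 1 ≤ k) (hk : k < s) (hsr : s ≤ r)
    (L : LinExt (M r s k)) (a : ℝ) (x : I r s (k + 1) → ℝ) (l : ℝ) :
    zeta hk L a x ∈ dilatedPolytope r s k l ↔ x ∈ dilatedPolytope r s (k + 1) l := by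
  obtain ⟨F, h⟩ := exists_shiftData hk1 hk hsr L a x
  have hmem : ∀ {m : ℕ}, m ≤ s → ∀ f : I r s m → ℝ, f ∈ dilatedPolytope r s m l ↔
      (∀ i j, InI r s m i j → 0 ≤ gridExtend f i j) ∧
      ∀ C : Finset (I r s m), IsPolygonal C → ∑ p ∈ C, gridExtend f p.1.1 p.1.2 ≤ l := by
    intro m hm f
    simp only [gridExtend_coe]
    refine and_congr ⟨fun hf i j hI => ?_, fun hf p => ?_⟩ Iff.rfl
    · rw [gridExtend_of_mem f (mem_I_iff.2 hI)]
      exact hf _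
    · rw [← gridExtend_coe f p]
      exact hf _ _ (mem_I_iff.1 p.2)
  rw [hmem hk.le, hmem (show k + 1 ≤ s from hk)]
  exact ⟨fun ⟨h1, h2⟩ => ⟨fun i j hI => h.x_nonneg h1 hI, fun C hC => h.sum_le' h2 hC⟩,
    fun ⟨h1, h2⟩ => ⟨fun i j hI => h.y_nonneg h1 hI, fun C hC => h.sum_le h2 hC⟩⟩

/-- The point (k, 1) is below every element with i ≥ k, and the border point (r+k-1, k) is above
every element with i < k. This makes the polytope bounded. -/
theorem exists_isPolygonal_mem (hk1 : 1 ≤ k) (hk : k ≤ s) (hsr : s ≤ r) (p : I r s k) :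
    ∃ C : Finset (I r s k), IsPolygonal C ∧ p ∈ C := by
  obtain ⟨⟨i, j⟩, hp⟩ := p
  have hI := mem_I_iff.1 hp
  have key : ∀ q : I r s k, (q ≤ ⟨(i, j), hp⟩ ∨ ⟨(i, j), hp⟩ ≤ q) →
      (q.1.1 + 1 = q.1.2 + r ∨ q.1 = (k, 1)) →
      ∃ C : Finset (I r s k), IsPolygonal C ∧ ⟨(i, j), hp⟩ ∈ C := by
    intro q hq hb
    have hchain : IsChain (· ≤ ·) ({q, ⟨(i, j), hp⟩} : Set (I r s k)) :=
      hq.elim (fun h => IsChain.pair h) fun h => Set.pair_comm q _ ▸ IsChain.pair h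
    obtain ⟨D, hD, hsub⟩ := exists_isMaxChain_superset hchain
    exact ⟨D, ⟨hD, hb.imp (fun h => ⟨q, hsub q (by simp), h⟩) fun h => ⟨q, hsub q (by simp), h⟩⟩,
      hsub _ (by simp)⟩
  by_cases hi : k ≤ i
  · refine key ⟨(k, 1), mem_I_iff.2 (by unfold InI; omega)⟩ (Or.inl ?_) (Or.inr rfl)
    exact Prod.mk_le_mk.2 ⟨hi, hI.2.1⟩
  · refine key ⟨(r + k - 1, k), mem_I_iff.2 (by unfold InI; omega)⟩ (Or.inr ?_)
      (Or.inl (by simp only; omega))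
    exact Prod.mk_le_mk.2 (by unfold InI at hI; omega)

theorem smul_chainPolytope (hk1 : 1 ≤ k) (hk : k ≤ s) (hsr : s ≤ r) {l : ℝ} (hl : 0 ≤ l) :
    l • chainPolytope r s k = dilatedPolytope r s k l := by
  rcases hl.lt_or_eq with hl | rfl
  · ext x
    rw [Set.mem_smul_set_iff_inv_smul_mem₀ hl.ne']
    simp only [chainPolytope, dilatedPolytope, Set.mem_ofPred_eq, Pi.smul_apply, smul_eq_mul,
      ← Finset.mul_sum]
    refine and_congr (forall_congr' fun p => ?_) (forall_congr' fun C => forall_congr' fun _ => ?_)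
    · rw [mul_nonneg_iff_of_pos_left (inv_pos.2 hl)]
    · rw [inv_mul_le_iff₀ hl, mul_one]
  -- For l = 0 the inequalities also leave only the origin, because polygonal chains cover the
  -- poset.
  · rw [Set.zero_smul_set ⟨0, by simp [chainPolytope]⟩]
    ext x
    simp only [Set.mem_zero, dilatedPolytope, Set.mem_ofPred_eq]
    constructor
    · rintro rfl
      simp
    · rintro ⟨h1, h2⟩
      funext p
      obtain ⟨C, hC, hp⟩ := exists_isPolygonal_mem hk1 hk hsr p
      exact le_antisymm ((Finset.single_le_sum (fun q _ => h1 q) hp).trans (h2 C hC)) (h1 p)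

/-! ### Independence of the choices, bijectivity and integrality of ζ_k -/

theorem IsLowerPotential.add_const {P : Type} [PartialOrder P] {x x' F : P → ℝ}
    (h : IsLowerPotential x F) (c : ℝ) (hmin : ∀ p, IsMin p → x' p = x p + c)
    (hne : ∀ p, ¬ IsMin p → x' p = x p) : IsLowerPotential x' fun p => F p + c where
  of_isMin := fun p hp => by rw [h.of_isMin p hp, hmin p hp]
  le_of_covBy := fun p q hqp => by
    have := h.le_of_covBy p q hqp
    rw [hne p fun hm => hm.not_lt hqp.1]
    linarith
  exists_eq := fun p hp => by
    obtain ⟨q, hqp, e⟩ := h.exists_eq p hp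
    exact ⟨q, hqp, by rw [hne p hp]; linarith⟩

theorem IsUpperPotential.add_const {P : Type} [PartialOrder P] {y y' F : P → ℝ}
    (h : IsUpperPotential y F) (c : ℝ) (hmax : ∀ p, IsMax p → y' p = y p - c)
    (hne : ∀ p, ¬ IsMax p → y' p = y p) : IsUpperPotential y' fun p => F p + c where
  of_isMax := fun p hp => by rw [hmax p hp, h.of_isMax p hp]; ring
  le_of_covBy := fun p q hqp => by
    have := h.le_of_covBy p q hqp
    rw [hne p fun hm => hm.not_lt hqp.1]
    linarith
  exists_eq := fun p hp => by
    obtain ⟨q, hqp, e⟩ := h.exists_eq p hp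
    exact ⟨q, hqp, by rw [hne p hp]; linarith⟩

/-- Replacing a by b at the minimum adds b - a to the whole potential. Differences of F are
unaffected, so only the label -F at the maximum changes. -/
theorem rowmotion_symm_extendLabel (hk1 : 1 ≤ k) (hk : k < s) (hsr : s ≤ r)
    (L L' : LinExt (M r s k)) (a b : ℝ) (x : I r s (k + 1) → ℝ) :
    (rowmotion L').symm (extendLabel b x) = fun p => if p.1 = (r + k, k + 1) then
      (rowmotion L).symm (extendLabel a x) p - (b - a)
      else (rowmotion L).symm (extendLabel a x) p := by
  obtain ⟨F, hF⟩ := exists_isLowerPotential (extendLabel a x : M r s k → ℝ)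
  obtain ⟨y, hy⟩ := exists_isUpperPotential F
  rw [rowmotion_symm_eq L hF hy]
  refine rowmotion_symm_eq L' (hF.add_const (b - a) (fun p hp => ?_) fun p hp => ?_)
    (hy.add_const (b - a) (fun p hp => ?_) fun p hp => ?_)
  · rw [M_isMin_iff hk1 hk hsr] at hp
    simp [extendLabel, hp]
  · rw [M_isMin_iff hk1 hk hsr] at hp
    simp [extendLabel, hp]
  · rw [if_pos ((M_isMax_iff hk1 hk).1 hp)]
  · rw [if_neg fun h => hp ((M_isMax_iff hk1 hk).2 h)]

theorem ne_top_of_mem_I {p : ℕ × ℕ} (hp : p ∈ I r s k) : p ≠ (r + k, k + 1) := by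
  rintro rfl
  have := mem_I_iff.1 hp
  unfold InI at this
  omega

theorem zeta_label_independent (hk1 : 1 ≤ k) (hk : k < s) (hsr : s ≤ r) (L L' : LinExt (M r s k))
    (a b : ℝ) (x : I r s (k + 1) → ℝ) : zeta hk L a x = zeta hk L' b x := by
  funext p
  unfold zeta
  split_ifs with hM
  · rw [rowmotion_symm_extendLabel hk1 hk hsr L L' a b x]
    exact (if_neg (ne_top_of_mem_I p.2)).symm
  · rfl
  · rfl

/-- The label at `(k, 1)` can be chosen so that inverse rowmotion takes a given value at the
maximum of `M r s k`. -/
theorem exists_label (hk1 : 1 ≤ k) (hk : k < s) (hsr : s ≤ r) (L : LinExt (M r s k))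
    (x : I r s (k + 1) → ℝ) (c : ℝ) :
    ∃ a : ℝ, ∀ p : M r s k, p.1 = (r + k, k + 1) →
      (rowmotion L).symm (extendLabel a x) p = c := by
  have hm : (r + k, k + 1) ∈ M r s k := (mem_M_iff hk1 hk).2 (by unfold InM; omega)
  refine ⟨(rowmotion L).symm (extendLabel 0 x) ⟨_, hm⟩ - c, fun p hp => ?_⟩
  obtain rfl : p = ⟨_, hm⟩ := Subtype.ext hp
  rw [rowmotion_symm_extendLabel hk1 hk hsr L L 0 _ x]
  simp

theorem eq_zeta_of_mem_M (hk1 : 1 ≤ k) {hk : k < s} {L : LinExt (M r s k)} {a : ℝ}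
    {x : I r s (k + 1) → ℝ} {p : ℕ × ℕ} (hM : p ∈ M r s k) (hp : p ≠ (r + k, k + 1)) :
    ∃ hI : p ∈ I r s k,
      (rowmotion L).symm (extendLabel a x) ⟨p, hM⟩ = zeta hk L a x ⟨p, hI⟩ := by
  obtain ⟨i, j⟩ := p
  have hI := mem_I_iff.2 (inI_of_inM hk1 hk ((mem_M_iff hk1 hk).1 hM) hp)
  exact ⟨hI, (zeta_of_mem hI hM).symm⟩

/-- Every label of `I r s (k + 1)` outside `M r s k` is a label of the image under `zeta`. -/
theorem exists_zeta_eq (hk1 : 1 ≤ k) (hk : k < s) (hsr : s ≤ r) {q : I r s (k + 1)}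
    (hM : q.1 ∉ M r s k) :
    ∃ p : I r s k, p.1 ∉ M r s k ∧ ∀ (L : LinExt (M r s k)) (a : ℝ) (x : I r s (k + 1) → ℝ),
      zeta hk L a x p = x q := by
  obtain ⟨⟨i, j⟩, hq⟩ := q
  have hI := mem_I_iff.1 hq
  rw [mem_M_iff hk1 hk] at hM
  by_cases hj : k + 1 < j
  · obtain ⟨i, rfl⟩ : ∃ i', i = i' + 1 := ⟨i - 1, by unfold InI at hI; omega⟩
    refine ⟨⟨(i, j), mem_I_iff.2 (by unfold InI at *; omega)⟩, ?_, fun L a x => ?_⟩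
    · rw [mem_M_iff hk1 hk]
      unfold InM
      omega
    · rw [zeta_above hk1 _ hj, gridExtend_of_mem x hq]
  · obtain ⟨j, rfl⟩ : ∃ j', j = j' + 1 := ⟨j - 1, by unfold InI at hI; omega⟩
    have hi : i < k := by unfold InI InM at *; omega
    refine ⟨⟨(i, j), mem_I_iff.2 (by unfold InI at *; omega)⟩, ?_, fun L a x => ?_⟩
    · rw [mem_M_iff hk1 hk]
      unfold InM
      omega
    · rw [zeta_below hk1 _ hi, gridExtend_of_mem x hq]

/-- Inside M_k, ζ_k forgets only the value of inverse rowmotion at (r+k, k+1). With the free label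
chosen so that this value is 0, the output of ζ_k determines that of inverse rowmotion, which is
bijective. -/
theorem zeta_injective (hk1 : 1 ≤ k) (hk : k < s) (hsr : s ≤ r) (L : LinExt (M r s k)) (a : ℝ) :
    Function.Injective (zeta hk L a) := by
  intro x x' hxx
  obtain ⟨b, hb⟩ := exists_label hk1 hk hsr L x 0
  obtain ⟨c, hc⟩ := exists_label hk1 hk hsr L x' 0
  rw [zeta_label_independent hk1 hk hsr L L a b x,
    zeta_label_independent hk1 hk hsr L L a c x'] at hxx
  have hext : extendLabel b x = (extendLabel c x' : M r s k → ℝ) := by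
    apply (rowmotion L).symm.injective
    funext p
    by_cases hp : p.1 = (r + k, k + 1)
    · rw [hb p hp, hc p hp]
    · obtain ⟨hI, e⟩ := eq_zeta_of_mem_M (L := L) (a := b) (x := x) (hk := hk) hk1 p.2 hp
      obtain ⟨_, e'⟩ := eq_zeta_of_mem_M (L := L) (a := c) (x := x') (hk := hk) hk1 p.2 hp
      rw [e, e', hxx]
  funext q
  by_cases hM : q.1 ∈ M r s k
  · have hq : q.1 ≠ (k, 1) := by
      intro h
      have := mem_I_iff.1 (h ▸ q.2)
      unfold InI at this
      omega
    have := congrFun hext ⟨q.1, hM⟩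
    simpa [extendLabel, hq] using this
  · obtain ⟨p, -, hp⟩ := exists_zeta_eq hk1 hk hsr hM
    rw [← hp L b x, hxx, hp L c x']

theorem zeta_surjective (hk1 : 1 ≤ k) (hk : k < s) (hsr : s ≤ r) (L : LinExt (M r s k)) (a : ℝ) :
    Function.Surjective (zeta hk L a) := by
  classical
  intro y
  have hm : (k, 1) ∈ M r s k := (mem_M_iff hk1 hk).2 (by unfold InM; omega)
  -- The extension by zero supplies the value at (r+k, k+1), which is not in I_k; the value of z at
  -- (k, 1) then serves as the free label.
  set z : M r s k → ℝ := rowmotion L fun p => gridExtend y p.1.1 p.1.2 with hz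
  set x : I r s (k + 1) → ℝ := fun q => if h : q.1 ∈ M r s k then z ⟨q.1, h⟩
    else if k + 1 < q.1.2 then gridExtend y (q.1.1 - 1) q.1.2
    else gridExtend y q.1.1 (q.1.2 - 1) with hx
  have hext : extendLabel (z ⟨_, hm⟩) x = z := by
    funext p
    by_cases hp : p.1 = (k, 1)
    · obtain rfl : p = ⟨_, hm⟩ := Subtype.ext hp
      simp [extendLabel]
    · simp [extendLabel, hp, hx]
  refine ⟨x, ?_⟩
  rw [zeta_label_independent hk1 hk hsr L L a (z ⟨_, hm⟩) x]
  funext ⟨⟨i, j⟩, hI⟩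
  have hI' := mem_I_iff.1 hI
  by_cases hM : (i, j) ∈ M r s k
  · rw [zeta_of_mem hI hM, hext, hz, Equiv.symm_apply_apply]
    exact gridExtend_of_mem y hI
  · by_cases hj : k + 1 < j
    · have h1 : (i + 1, j) ∈ I r s (k + 1) := mem_I_succ_of_above hk hI hj
      have h2 : (i + 1, j) ∉ M r s k := by
        rw [mem_M_iff hk1 hk]
        unfold InM
        omega
      rw [zeta_above hk1 hI hj, gridExtend_of_mem x h1, hx]
      simp [h2, hj, gridExtend_of_mem y hI]
    · have hi : i < k := (below_iff hI hM).1 hj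
      have h1 : (i, j + 1) ∈ I r s (k + 1) := mem_I_succ_of_below hk hI hM hj
      have h2 : (i, j + 1) ∉ M r s k := by
        rw [mem_M_iff hk1 hk]
        unfold InM
        omega
      have h3 : ¬ k < j := by unfold InI at hI'; omega
      rw [zeta_below hk1 hI hi, gridExtend_of_mem x h1, hx]
      simp [h2, h3, gridExtend_of_mem y hI]

theorem zeta_mem_lattice_iff (hk1 : 1 ≤ k) (hk : k < s) (hsr : s ≤ r) (L : LinExt (M r s k))
    (a : ℝ) (x : I r s (k + 1) → ℝ) :
    x ∈ lattice (I r s (k + 1)) ↔ zeta hk L a x ∈ lattice (I r s k) := by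
  constructor
  · intro hx
    rw [zeta_label_independent hk1 hk hsr L L a 0 x]
    have h1 : extendLabel 0 x ∈ lattice (M r s k) := by
      intro p
      unfold extendLabel
      split_ifs
      · exact ⟨0, by simp⟩
      · exact hx _
    rw [← rowmotion_symm_mem_lattice_iff L] at h1
    intro p
    unfold zeta
    split_ifs
    · exact h1 _
    · exact hx _
    · exact hx _
  · intro hz
    -- With the forgotten value set to 0, the output of inverse rowmotion is integral on all of M_k.
    obtain ⟨b, hb⟩ := exists_label hk1 hk hsr L x 0
    rw [zeta_label_independent hk1 hk hsr L L a b x] at hz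
    have h1 : extendLabel b x ∈ lattice (M r s k) := by
      rw [← rowmotion_symm_mem_lattice_iff L]
      intro p
      by_cases hp : p.1 = (r + k, k + 1)
      · exact ⟨0, by rw [hb p hp]; simp⟩
      · obtain ⟨hI, e⟩ := eq_zeta_of_mem_M (L := L) (a := b) (x := x) (hk := hk) hk1 p.2 hp
        rw [e]
        exact hz _
    intro q
    by_cases hM : q.1 ∈ M r s k
    · have hq : q.1 ≠ (k, 1) := by
        intro h
        have := mem_I_iff.1 (h ▸ q.2)
        unfold InI at this
        omega
      have := h1 ⟨q.1, hM⟩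
      simpa [extendLabel, hq] using this
    · obtain ⟨p, -, hp⟩ := exists_zeta_eq hk1 hk hsr hM
      rw [← hp L b x]
      exact hz p

theorem zeta_bijOn (hk1 : 1 ≤ k) (hk : k < s) (hsr : s ≤ r) (L : LinExt (M r s k)) (a : ℝ)
    {l : ℝ} (hl : 0 ≤ l) :
    Set.BijOn (zeta hk L a) (l • chainPolytope r s (k + 1)) (l • chainPolytope r s k) := by
  rw [smul_chainPolytope (by omega) hk hsr hl, smul_chainPolytope hk1 hk.le hsr hl]
  refine ⟨fun x hx => (zeta_mem_dilatedPolytope_iff hk1 hk hsr L a x l).2 hx,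
    (zeta_injective hk1 hk hsr L a).injOn, fun y hy => ?_⟩
  obtain ⟨x, rfl⟩ := zeta_surjective hk1 hk hsr L a y
  exact ⟨x, (zeta_mem_dilatedPolytope_iff hk1 hk hsr L a x l).1 hy, rfl⟩

end Interval

/-! ### Continuity and piecewise linearity -/

section PiecewiseLinear

variable {ι κ μ : Type}

theorem IsPolyhedron.inter {Q R : Set (ι → ℝ)} (hQ : IsPolyhedron Q) (hR : IsPolyhedron R) :
    IsPolyhedron (Q ∩ R) := by
  obtain ⟨H, hH, rfl⟩ := hQ
  obtain ⟨K, hK, rfl⟩ := hR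
  refine ⟨H ∪ K, hH.union hK, ?_⟩
  ext x
  simp only [Set.mem_inter_iff, Set.mem_ofPred_eq, Set.mem_union, or_imp, forall_and]

theorem IsPolyhedron.preimage {R : Set (κ → ℝ)} (hR : IsPolyhedron R)
    (A : (ι → ℝ) →ᵃ[ℝ] (κ → ℝ)) : IsPolyhedron (A ⁻¹' R) := by
  obtain ⟨K, hK, rfl⟩ := hR
  refine ⟨(fun h => (h.1.comp A.linear, h.2 - h.1 (A 0))) '' K, hK.image _, ?_⟩
  ext x
  simp only [Set.mem_preimage, Set.mem_ofPred_eq, Set.forall_mem_image, LinearMap.comp_apply]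
  refine forall_congr' fun h => forall_congr' fun _ => ?_
  have : A x = A.linear x + A 0 := by
    have := A.map_vadd 0 x
    simpa using this
  rw [this, map_add, le_sub_iff_add_le]

theorem IsPiecewiseLinear.comp {g : (κ → ℝ) → (μ → ℝ)} {f : (ι → ℝ) → (κ → ℝ)}
    (hg : IsPiecewiseLinear g) (hf : IsPiecewiseLinear f) : IsPiecewiseLinear (g ∘ f) := by
  obtain ⟨𝒬, h𝒬, hcov, h1⟩ := hf
  obtain ⟨ℛ, hℛ, hcov', h2⟩ := hg
  choose! hp A hA using h1
  refine ⟨Set.image2 (fun Q R => Q ∩ A Q ⁻¹' R) 𝒬 ℛ, h𝒬.image2 _ hℛ, ?_, ?_⟩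
  · refine Set.eq_univ_of_forall fun x => ?_
    obtain ⟨Q, hQ, hx⟩ := Set.mem_sUnion.1 (hcov.symm ▸ Set.mem_univ x : x ∈ ⋃₀ 𝒬)
    obtain ⟨R, hR, hx'⟩ := Set.mem_sUnion.1 (hcov'.symm ▸ Set.mem_univ (A Q x) : A Q x ∈ ⋃₀ ℛ)
    exact ⟨_, Set.mem_image2_of_mem hQ hR, hx, hx'⟩
  · rintro _ ⟨Q, hQ, R, hR, rfl⟩
    obtain ⟨hpR, B, hB⟩ := h2 R hR
    refine ⟨(hp Q hQ).inter (hpR.preimage _), B.comp (A Q), fun x hx => ?_⟩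
    simp only [Function.comp_apply, AffineMap.comp_apply]
    rw [hA Q hQ hx.1, hB hx.2]

theorem isPiecewiseLinear_affine (A : (ι → ℝ) →ᵃ[ℝ] (κ → ℝ)) : IsPiecewiseLinear A :=
  ⟨{Set.univ}, Set.finite_singleton _, by simp, fun Q hQ => by
    rw [Set.mem_singleton_iff.1 hQ]
    exact ⟨⟨∅, Set.finite_empty, by simp⟩, A, fun _ _ => rfl⟩⟩

section Toggle

variable {P : Type} [PartialOrder P] [Fintype P]

theorem toggleFun_continuous (p : P) : Continuous (toggleFun p) := by
  classical
  refine continuous_pi fun q => ?_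
  by_cases h : q = p
  · subst h
    simp only [toggleFun_apply_self]
    exact (Continuous.finset_sup'_apply _ fun C _ => by fun_prop).neg
  · simp only [toggleFun_apply_of_ne _ _ h]
    exact continuous_apply q

/-- There is one piece for each maximal chain through p: the labelings for which this chain has the
largest sum. -/
theorem toggleFun_isPiecewiseLinear (p : P) : IsPiecewiseLinear (toggleFun p) := by
  classical
  let S : Finset P → (P → ℝ) →ₗ[ℝ] ℝ := fun C => ∑ q ∈ C, LinearMap.proj q
  have hS : ∀ C x, S C x = ∑ q ∈ C, x q := fun C x => by simp [S]
  refine ⟨(fun C => {x | ∀ D ∈ maxChainsThrough p, S D x ≤ S C x}) '' (maxChainsThrough p : Set _),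
    (Finset.finite_toSet _).image _, Set.eq_univ_of_forall fun x => ?_, ?_⟩
  · obtain ⟨C, hC, hmax⟩ := Finset.exists_max_image (maxChainsThrough p) (fun C => S C x)
      (maxChainsThrough_nonempty p)
    exact ⟨_, Set.mem_image_of_mem _ hC, hmax⟩
  · rintro _ ⟨C, hC, rfl⟩
    refine ⟨⟨(fun D => (S D - S C, 0)) '' (maxChainsThrough p : Set _),
      (Finset.finite_toSet _).image _, ?_⟩,
      (LinearMap.pi fun q => if q = p then -S C else LinearMap.proj q).toAffineMap, ?_⟩
    · ext x
      simp
    · intro x hx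
      funext q
      by_cases h : q = p
      · subst h
        rw [toggleFun_apply_self]
        simp only [LinearMap.coe_toAffineMap, LinearMap.pi_apply, if_true, LinearMap.neg_apply,
          neg_inj, hS]
        refine le_antisymm (Finset.sup'_le _ _ fun D hD => ?_)
          (Finset.le_sup' (fun C => ∑ q ∈ C, x q) hC)
        have := hx D hD
        rwa [hS, hS] at this
      · rw [toggleFun_apply_of_ne _ _ h]
        simp [h]

theorem rowmotion_symm_induction {p : ((P → ℝ) → (P → ℝ)) → Prop} (L : LinExt P) (hid : p id)
    (hcomp : ∀ f g, p f → p g → p (f ∘ g)) (htog : ∀ a, p (toggleFun a)) :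
    p (rowmotion L).symm := by
  have : ∀ l : List (Equiv.Perm (P → ℝ)), (∀ t ∈ l, p t.symm) → p l.prod.symm := by
    intro l
    induction l with
    | nil => exact fun _ => hid
    | cons t l ih =>
      intro h
      rw [List.prod_cons]
      exact hcomp l.prod.symm t.symm (ih fun u hu => h u (List.mem_cons_of_mem _ hu))
        (h t List.mem_cons_self)
  refine this _ fun t ht => ?_
  obtain ⟨i, rfl⟩ := (List.mem_ofFn' _ _).1 (List.mem_reverse.1 ht)
  exact htog _

theorem rowmotion_symm_continuous (L : LinExt P) : Continuous (rowmotion L).symm :=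
  rowmotion_symm_induction L continuous_id (fun _ _ hf hg => hf.comp hg) toggleFun_continuous

theorem rowmotion_symm_isPiecewiseLinear (L : LinExt P) : IsPiecewiseLinear (rowmotion L).symm :=
  rowmotion_symm_induction L (isPiecewiseLinear_affine (AffineMap.id ℝ _))
    (fun _ _ hf hg => hf.comp hg) toggleFun_isPiecewiseLinear

end Toggle

section Zeta

variable {r s k : ℕ}

theorem extendLabel_continuous (a : ℝ) :
    Continuous (extendLabel a : (I r s (k + 1) → ℝ) → M r s k → ℝ) := by
  refine continuous_pi fun p => ?_
  unfold extendLabel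
  split_ifs
  · exact continuous_const
  · exact continuous_apply _

theorem zeta_continuous (hk : k < s) (L : LinExt (M r s k)) (a : ℝ) :
    Continuous (zeta hk L a) := by
  refine continuous_pi fun p => ?_
  unfold zeta
  split_ifs
  · exact (continuous_apply _).comp ((rowmotion_symm_continuous L).comp (extendLabel_continuous a))
  · exact continuous_apply _
  · exact continuous_apply _

theorem extendLabel_isPiecewiseLinear (a : ℝ) :
    IsPiecewiseLinear (extendLabel a : (I r s (k + 1) → ℝ) → M r s k → ℝ) := by
  let A : (I r s (k + 1) → ℝ) →ᵃ[ℝ] (M r s k → ℝ) := AffineMap.pi fun p =>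
    if h : p.1 = (k, 1) then AffineMap.const ℝ _ a
    else (LinearMap.proj (⟨p.1, mem_I_succ_of_mem_M p.2 h⟩ : I r s (k + 1))).toAffineMap
  have : (extendLabel a : (I r s (k + 1) → ℝ) → M r s k → ℝ) = A := by
    funext x p
    simp only [extendLabel, A, AffineMap.pi_apply]
    split_ifs <;> rfl
  rw [this]
  exact isPiecewiseLinear_affine A

theorem zeta_isPiecewiseLinear (hk : k < s) (L : LinExt (M r s k)) (a : ℝ) :
    IsPiecewiseLinear (zeta hk L a) := by
  obtain ⟨𝒬, h𝒬, hcov, h⟩ :=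
    (rowmotion_symm_isPiecewiseLinear L).comp (extendLabel_isPiecewiseLinear (r := r) (s := s) a)
  refine ⟨𝒬, h𝒬, hcov, fun Q hQ => ?_⟩
  obtain ⟨hp, A, hA⟩ := h Q hQ
  refine ⟨hp, AffineMap.pi fun p =>
    if hM : p.1 ∈ M r s k then (LinearMap.proj (⟨p.1, hM⟩ : M r s k)).toAffineMap.comp A
    else if h : k + 1 < p.1.2 then
      (LinearMap.proj (⟨(p.1.1 + 1, p.1.2), mem_I_succ_of_above hk p.2 h⟩ :
        I r s (k + 1))).toAffineMap
    else (LinearMap.proj (⟨(p.1.1, p.1.2 + 1), mem_I_succ_of_below hk p.2 hM h⟩ :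
        I r s (k + 1))).toAffineMap, fun x hx => ?_⟩
  have hx := hA hx
  funext p
  simp only [zeta, AffineMap.pi_apply]
  split_ifs
  · exact congrFun hx _
  · rfl
  · rfl

end Zeta

end PiecewiseLinear

/-! ### Rationality of packing polytopes -/

section Rational

variable {ι : Type}

/-- The polytope of nonnegative labelings whose sum over each member of `𝒞` is at most one. -/
def packingPolytope (𝒞 : Set (Finset ι)) : Set (ι → ℝ) :=
  {x | (∀ p, 0 ≤ x p) ∧ ∀ C ∈ 𝒞, ∑ p ∈ C, x p ≤ 1}

variable {𝒞 : Set (Finset ι)}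

theorem packingPolytope_convex : Convex ℝ (packingPolytope 𝒞) := by
  intro x hx y hy a b ha hb hab
  refine ⟨fun p => ?_, fun C hC => ?_⟩
  · have := mul_nonneg ha (hx.1 p)
    have := mul_nonneg hb (hy.1 p)
    simp only [Pi.add_apply, Pi.smul_apply, smul_eq_mul]
    linarith
  · have h1 := mul_le_mul_of_nonneg_left (hx.2 C hC) ha
    have h2 := mul_le_mul_of_nonneg_left (hy.2 C hC) hb
    simp only [Pi.add_apply, Pi.smul_apply, smul_eq_mul, Finset.sum_add_distrib, ← Finset.mul_sum]
    linarith

theorem packingPolytope_isCompact (hcov : ∀ p, ∃ C ∈ 𝒞, p ∈ C) :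
    IsCompact (packingPolytope 𝒞) := by
  refine (isCompact_Icc (a := (0 : ι → ℝ)) (b := 1)).of_isClosed_subset ?_ fun x hx => ?_
  · have : packingPolytope 𝒞 = (⋂ p, {x : ι → ℝ | 0 ≤ x p}) ∩
        ⋂ C ∈ 𝒞, {x : ι → ℝ | ∑ p ∈ C, x p ≤ 1} := by
      ext x
      simp [packingPolytope]
    rw [this]
    refine (isClosed_iInter fun p => isClosed_le continuous_const (continuous_apply p)).inter
      (isClosed_biInter fun C _ => isClosed_le (by fun_prop) continuous_const)
  · refine ⟨fun p => hx.1 p, fun p => ?_⟩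
    obtain ⟨C, hC, hp⟩ := hcov p
    exact (Finset.single_le_sum (fun q _ => hx.1 q) hp).trans (hx.2 C hC)

variable [Fintype ι]

/-- An extreme point is determined by its tight constraints. -/
theorem eq_zero_of_mem_extremePoints {v u : ι → ℝ}
    (hv : v ∈ (packingPolytope 𝒞).extremePoints ℝ) (h0 : ∀ p, v p = 0 → u p = 0)
    (h1 : ∀ C ∈ 𝒞, ∑ p ∈ C, v p = 1 → ∑ p ∈ C, u p = 0) : u = 0 := by
  have hvm := hv.1
  -- Slack constraints survive a small perturbation by continuity, and u vanishes on the tight ones.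
  -- With c = 1 and c = -1 this makes v the midpoint of a segment in the polytope.
  have hnear : ∀ c : ℝ, ∀ᶠ ε in nhds (0 : ℝ), v + (ε * c) • u ∈ packingPolytope 𝒞 := by
    intro c
    have e1 : ∀ᶠ ε in nhds (0 : ℝ), ∀ p, 0 ≤ v p + (ε * c) * u p := by
      refine Filter.eventually_all.2 fun p => ?_
      rcases (hvm.1 p).lt_or_eq with hp | hp
      · have ht : Filter.Tendsto (fun ε : ℝ => v p + (ε * c) * u p) (nhds 0)
            (nhds (v p + (0 * c) * u p)) := Continuous.tendsto (by fun_prop) 0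
        rw [zero_mul, zero_mul, add_zero] at ht
        exact (ht.eventually_const_lt hp).mono fun _ h => h.le
      · simp [h0 p hp.symm, ← hp]
    have e2 : ∀ᶠ ε in nhds (0 : ℝ), ∀ C ∈ 𝒞, ∑ p ∈ C, v p + (ε * c) * ∑ p ∈ C, u p ≤ 1 := by
      refine (Set.toFinite 𝒞).eventually_all.2 fun C hC => ?_
      rcases (hvm.2 C hC).lt_or_eq with hp | hp
      · have ht : Filter.Tendsto (fun ε : ℝ => ∑ p ∈ C, v p + (ε * c) * ∑ p ∈ C, u p) (nhds 0)
            (nhds (∑ p ∈ C, v p + (0 * c) * ∑ p ∈ C, u p)) := Continuous.tendsto (by fun_prop) 0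
        rw [zero_mul, zero_mul, add_zero] at ht
        exact (ht.eventually_lt_const hp).mono fun _ h => h.le
      · simp [h1 C hC hp, hp]
    filter_upwards [e1, e2] with ε g1 g2
    refine ⟨g1, fun C hC => ?_⟩
    simpa [Finset.sum_add_distrib, ← Finset.mul_sum] using g2 C hC
  have hboth := ((hnear 1).and (hnear (-1))).filter_mono (nhdsWithin_le_nhds (s := Set.Ioi 0))
  obtain ⟨ε, ⟨g1, g2⟩, hε⟩ := (hboth.and self_mem_nhdsWithin).exists
  have hε : 0 < ε := hε
  have hseg : v ∈ openSegment ℝ (v + (ε * 1) • u) (v + (ε * -1) • u) := by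
    refine ⟨1 / 2, 1 / 2, by norm_num, by norm_num, by norm_num, ?_⟩
    ext p
    simp only [Pi.add_apply, Pi.smul_apply, smul_eq_mul]
    ring
  have := ((mem_extremePoints.1 hv).2 _ g1 _ g2 hseg).1
  have h3 : (ε * 1) • u = 0 := by simpa using this
  exact (smul_eq_zero.1 h3).resolve_left (by simpa using hε.ne')

/-- A ℚ-linear retraction π of ℝ onto ℚ, applied coordinatewise, preserves the tight constraints
because their data are rational. So v - π(v) solves the homogeneous tight system and vanishes. -/
theorem rational_of_mem_extremePoints {v : ι → ℝ}
    (hv : v ∈ (packingPolytope 𝒞).extremePoints ℝ) (i : ι) : ∃ t : ℚ, v i = t := by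
  obtain ⟨π, hπ⟩ := LinearMap.exists_leftInverse_of_injective (Algebra.linearMap ℚ ℝ)
    (LinearMap.ker_eq_bot.2 (algebraMap ℚ ℝ).injective)
  have hπ1 : π 1 = 1 := by
    have := LinearMap.congr_fun hπ 1
    simpa using this
  have hu := eq_zero_of_mem_extremePoints (u := fun p => v p - (π (v p) : ℝ)) hv
    (fun p hp => by simp [hp]) fun C _ hC => by
      rw [Finset.sum_sub_distrib, hC]
      have := congrArg π hC
      rw [map_sum, hπ1] at this
      rw [← Rat.cast_sum, this]
      simp
  exact ⟨π (v i), sub_eq_zero.1 (congrFun hu i)⟩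

/-- Extreme points with the same tight constraints coincide, and there are finitely many possible
sets of tight constraints. -/
theorem extremePoints_packingPolytope_finite :
    ((packingPolytope 𝒞).extremePoints ℝ).Finite := by
  let φ : (ι → ℝ) → Set ι × Set (Finset ι) := fun v =>
    ({p | v p = 0}, {C | ∑ p ∈ C, v p = 1})
  refine Set.Finite.of_finite_image (f := φ) (Set.toFinite _) fun v hv w hw h => ?_
  have h1 : ∀ p, v p = 0 ↔ w p = 0 := fun p => Set.ext_iff.1 (Prod.ext_iff.1 h).1 p
  have h2 : ∀ C, ∑ p ∈ C, v p = 1 ↔ ∑ p ∈ C, w p = 1 :=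
    fun C => Set.ext_iff.1 (Prod.ext_iff.1 h).2 C
  refine sub_eq_zero.1 (eq_zero_of_mem_extremePoints (u := v - w) hv (fun p hp => ?_)
    fun C _ hC => ?_)
  · simp [hp, (h1 p).1 hp]
  · simp [hC, (h2 C).1 hC]

theorem packingPolytope_isRationalPolytope (hcov : ∀ p, ∃ C ∈ 𝒞, p ∈ C) :
    IsRationalPolytope (packingPolytope 𝒞) := by
  refine ⟨_, extremePoints_packingPolytope_finite (𝒞 := 𝒞),
    fun v hv => rational_of_mem_extremePoints hv, ?_⟩
  -- Krein–Milman gives the closed convex hull of the extreme points; finiteness makes the closure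
  -- superfluous.
  rw [← (extremePoints_packingPolytope_finite.isClosed_convexHull ℝ).closure_eq]
  exact (closure_convexHull_extremePoints (packingPolytope_isCompact hcov)
    packingPolytope_convex).symm

theorem IsRationalPolytope.exists_smul_isLatticePolytope {Q : Set (ι → ℝ)}
    (hQ : IsRationalPolytope Q) : ∃ n : ℕ, 0 < n ∧ IsLatticePolytope ((n : ℝ) • Q) := by
  obtain ⟨V, hV, hrat, rfl⟩ := hQ
  choose! t ht using hrat
  set n : ℕ := ∏ v ∈ hV.toFinset, ∏ i, (t v i).den with hn
  refine ⟨n, Finset.prod_pos fun v _ => Finset.prod_pos fun i _ => (t v i).pos,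
    (n : ℝ) • V, hV.smul_set, ?_, (convexHull_smul _ _).symm⟩
  rintro _ ⟨v, hv, rfl⟩ i
  have hdvd : (t v i).den ∣ n :=
    (Finset.dvd_prod_of_mem (fun i => (t v i).den) (Finset.mem_univ i)).trans
      (Finset.dvd_prod_of_mem (fun v => ∏ i, (t v i).den) (hV.mem_toFinset.2 hv))
  obtain ⟨m, hm⟩ := hdvd
  refine ⟨(t v i).num * m, ?_⟩
  have h1 : ((t v i).den : ℝ) * (t v i : ℝ) = (t v i).num := by
    rw [mul_comm]
    exact_mod_cast Rat.mul_den_eq_num (t v i)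
  simp only [Pi.smul_apply, smul_eq_mul]
  rw [ht v hv i, hm]
  push_cast
  rw [← h1]
  ring

theorem one_lt_denominator {Q : Set (ι → ℝ)} (hQ : IsRationalPolytope Q)
    (hl : ¬ IsLatticePolytope Q) : 1 < denominator Q := by
  obtain ⟨h1, h2⟩ : 0 < denominator Q ∧ IsLatticePolytope ((denominator Q : ℝ) • Q) :=
    Nat.sInf_mem hQ.exists_smul_isLatticePolytope
  refine lt_of_le_of_ne h1 fun h => hl ?_
  rw [← h] at h2
  simpa using h2

end Rational

/-! ### Order polynomials -/

section OrderPolynomial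

open Classical in
/-- The number of order-preserving surjections `P → Fin n`. -/
def surjectionCount (P : Type) [PartialOrder P] [Fintype P] (n : ℕ) : ℕ :=
  (Finset.univ.filter fun f : P → Fin n => Monotone f ∧ Function.Surjective f).card

variable {P : Type} [PartialOrder P] [Fintype P]

open Classical in
-- A monotone map with image S factors uniquely as a monotone surjection onto a chain of size |S|
-- followed by the increasing enumeration of S.
theorem card_monotone_image_eq {m : ℕ} (S : Finset (Fin m)) :
    (Finset.univ.filter fun f : P → Fin m => Monotone f ∧ Finset.univ.image f = S).card =
      surjectionCount P S.card := by
  symm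
  let e := S.orderEmbOfFin rfl
  have hrange : ∀ a, a ∈ S ↔ ∃ i, e i = a := fun a => by
    have := Finset.range_orderEmbOfFin S rfl
    rw [← Finset.mem_coe, ← this, Set.mem_range]
  refine Finset.card_bij (fun g _ => e ∘ g) ?_ ?_ ?_
  · intro g hg
    simp only [Finset.mem_filter, Finset.mem_univ, true_and] at hg ⊢
    refine ⟨e.monotone.comp hg.1, ?_⟩
    ext a
    rw [hrange]
    simp only [Finset.mem_image, Finset.mem_univ, true_and, Function.comp_apply]
    constructor
    · rintro ⟨p, hp⟩
      exact ⟨g p, hp⟩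
    · rintro ⟨i, hi⟩
      obtain ⟨p, rfl⟩ := hg.2 i
      exact ⟨p, hi⟩
  · intro g _ g' _ h
    funext p
    exact e.injective (congrFun h p)
  · intro f hf
    simp only [Finset.mem_filter, Finset.mem_univ, true_and] at hf
    obtain ⟨hmono, him⟩ := hf
    have : ∀ p, ∃ i, e i = f p := fun p =>
      (hrange _).1 (him ▸ Finset.mem_image_of_mem f (Finset.mem_univ p))
    choose g hg using this
    refine ⟨g, ?_, funext hg⟩
    simp only [Finset.mem_filter, Finset.mem_univ, true_and]
    refine ⟨fun p q hpq => e.le_iff_le.1 (by rw [hg, hg]; exact hmono hpq), fun i => ?_⟩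
    have : e i ∈ Finset.univ.image f := him ▸ (hrange _).2 ⟨i, rfl⟩
    obtain ⟨p, -, hp⟩ := Finset.mem_image.1 this
    exact ⟨p, e.injective (by rw [hg, hp])⟩

open Classical in
theorem card_monotone_eq (m : ℕ) :
    (Finset.univ.filter fun f : P → Fin m => Monotone f).card =
      ∑ j ∈ Finset.range (Fintype.card P + 1), m.choose j * surjectionCount P j := by
  have h1 : (Finset.univ.filter fun f : P → Fin m => Monotone f).card =
      ∑ S ∈ (Finset.univ : Finset (Fin m)).powerset, surjectionCount P S.card := by
    rw [Finset.card_eq_sum_card_fiberwise (f := fun f => Finset.univ.image f)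
      (t := (Finset.univ : Finset (Fin m)).powerset) (fun f _ => by simp)]
    refine Finset.sum_congr rfl fun S _ => ?_
    rw [← card_monotone_image_eq S, Finset.filter_filter]
  have hzero : ∀ j, Fintype.card P < j → surjectionCount P j = 0 := by
    intro j hj
    rw [surjectionCount, Finset.card_eq_zero, Finset.filter_eq_empty_iff]
    rintro f - ⟨-, hf⟩
    have := Fintype.card_le_of_surjective f hf
    rw [Fintype.card_fin] at this
    omega
  rw [h1, Finset.sum_powerset_apply_card (fun j => surjectionCount P j), Finset.card_univ,
    Fintype.card_fin]
  simp only [smul_eq_mul]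
  -- Both sums extend to a common range: the binomial coefficient vanishes for j > m, the surjection
  -- count for j > |P|.
  rw [Finset.sum_subset (s₂ := Finset.range (m + Fintype.card P + 1))
      (Finset.range_subset_range.2 (by omega)) fun j _ hj => ?_,
    ← Finset.sum_subset (s₁ := Finset.range (Fintype.card P + 1))
      (Finset.range_subset_range.2 (by omega)) fun j _ hj => ?_]
  · rw [hzero j (by simpa using hj), mul_zero]
  · rw [Nat.choose_eq_zero_of_lt (by simpa using hj), zero_mul]

open Classical in
/-- The number of order-preserving maps into a finite chain is a polynomial in its size. -/
theorem exists_orderPolynomial (P : Type) [PartialOrder P] [Fintype P] :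
    ∃ E : Polynomial ℚ, ∀ m : ℕ,
      ((Finset.univ.filter fun f : P → Fin m => Monotone f).card : ℚ) = E.eval (m : ℚ) := by
  refine ⟨∑ j ∈ Finset.range (Fintype.card P + 1),
    Polynomial.C ((surjectionCount P j : ℚ) / j.factorial) * descPochhammer ℚ j, fun m => ?_⟩
  rw [card_monotone_eq, Polynomial.eval_finsetSum, Nat.cast_sum]
  refine Finset.sum_congr rfl fun j _ => ?_
  rw [Polynomial.eval_mul, Polynomial.eval_C, descPochhammer_eval_eq_descFactorial,
    Nat.descFactorial_eq_factorial_mul_choose]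
  have : (j.factorial : ℚ) ≠ 0 := by exact_mod_cast j.factorial_ne_zero
  push_cast
  field_simp

/-! ### Stanley's transfer map from the chain polytope to the order polytope -/

theorem IsLowerPotential.unique {x F F' : P → ℝ} (h : IsLowerPotential x F)
    (h' : IsLowerPotential x F') : F = F' := by
  funext p
  induction p using WellFoundedLT.induction with
  | ind p ih =>
    by_cases hm : IsMin p
    · rw [h.of_isMin p hm, h'.of_isMin p hm]
    · obtain ⟨q, hq, e⟩ := h.exists_eq p hm
      obtain ⟨q', hq', e'⟩ := h'.exists_eq p hm
      have h1 := h.le_of_covBy p q' hq'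
      have h2 := h'.le_of_covBy p q hq
      have := ih q hq.1
      have := ih q' hq'.1
      linarith

theorem exists_labeling (F : P → ℝ) : ∃ x, IsLowerPotential x F := by
  obtain ⟨x, hx⟩ := exists_isUpperPotential (P := Pᵒᵈ) fun p => -F p
  have := hx.dual
  simp only [neg_neg] at this
  exact ⟨x, this⟩

/-- Nonnegative labels correspond to nonnegative monotone potentials, since each label is F p itself
or a difference of F along a cover. The bound on chain sums becomes F ≤ l, since F p is the sum over
some chain ending at p and bounds all such sums. -/
theorem bijOn_lowerPotential (l : ℕ) :
    Set.BijOn lowerPotential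
      ({x : P → ℝ | (∀ p, 0 ≤ x p) ∧
        ∀ C : Finset P, IsMaxChain (· ≤ ·) (C : Set P) → ∑ p ∈ C, x p ≤ l} ∩ lattice P)
      {F | Monotone F ∧ (∀ p, 0 ≤ F p ∧ F p ≤ l) ∧ F ∈ lattice P} := by
  classical
  refine ⟨?_, ?_, ?_⟩
  · rintro x ⟨⟨h0, h1⟩, hx⟩
    have hF := lowerPotential_isLowerPotential x
    have hsum : ∀ p, lowerPotential x p ≤ l ∧ 0 ≤ lowerPotential x p := by
      intro p
      obtain ⟨C, hC, hs⟩ := hF.exists_chain p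
      obtain ⟨D, hD, hCD⟩ := exists_isMaxChain_superset hC.chain
      rw [← hs]
      exact ⟨(Finset.sum_le_sum_of_subset_of_nonneg hCD fun q _ _ => h0 q).trans (h1 D hD),
        Finset.sum_nonneg fun q _ => h0 q⟩
    refine ⟨fun p q hpq => ?_, fun p => ⟨(hsum p).2, (hsum p).1⟩, hF.mem_lattice_iff.1 hx⟩
    induction q using WellFoundedLT.induction with
    | ind q ih =>
      rcases hpq.lt_or_eq with h | rfl
      · obtain ⟨z, hpz, hzq⟩ := exists_le_covBy_of_lt h
        have := ih z hzq.1 hpz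
        have := hF.le_of_covBy q z hzq
        have := h0 q
        linarith
      · exact le_rfl
  · intro x _ x' _ h
    have h' := lowerPotential_isLowerPotential x'
    rw [← h] at h'
    exact (lowerPotential_isLowerPotential x).unique_labeling h'
  · rintro F ⟨hmono, hb, hF⟩
    obtain ⟨x, hx⟩ := exists_labeling F
    refine ⟨x, ⟨⟨fun p => ?_, fun C hC => ?_⟩, hx.mem_lattice_iff.2 hF⟩,
      (lowerPotential_isLowerPotential x).unique hx⟩
    · by_cases hm : IsMin p
      · rw [← hx.of_isMin p hm]
        exact (hb p).1
      · obtain ⟨q, hq, e⟩ := hx.exists_eq p hm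
        have := hmono hq.1.le
        linarith
    · rcases C.eq_empty_or_nonempty with rfl | hne
      · simp
      · obtain ⟨p, hp⟩ := Finset.exists_maximal hne
        have hle : ∀ z ∈ C, z ≤ p := fun z hz => by
          rcases hC.1.total hz hp.prop with h | h
          · exact h
          · exact hp.le_of_ge hz h
        rw [sum_eq_sum_lt_add_sum_gt hC.1 hp.prop, Finset.filter_false_of_mem (p := (p < ·))
          fun q hq => (hle q hq).not_gt, Finset.sum_empty, add_zero]
        exact (hx.sum_le hC hp.prop).trans (hb p).2

theorem exists_polynomial_ncard (P : Type) [PartialOrder P] [Fintype P] :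
    ∃ E : Polynomial ℚ, ∀ l : ℕ,
      ((({x : P → ℝ | (∀ p, 0 ≤ x p) ∧
        ∀ C : Finset P, IsMaxChain (· ≤ ·) (C : Set P) → ∑ p ∈ C, x p ≤ l} ∩
          lattice P).ncard : ℕ) : ℚ) = E.eval (l : ℚ) := by
  classical
  obtain ⟨E, hE⟩ := exists_orderPolynomial P
  -- The values 0, …, l form a chain of l + 1 elements, hence the shift of the order polynomial.
  refine ⟨E.comp (Polynomial.X + 1), fun l => ?_⟩
  rw [Polynomial.eval_comp, Polynomial.eval_add, Polynomial.eval_X, Polynomial.eval_one]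
  have hE := hE (l + 1)
  push_cast at hE
  rw [← hE, Nat.cast_inj]
  have hb := bijOn_lowerPotential (P := P) l
  rw [hb.ncard_eq, ← Set.ncard_coe_finset]
  symm
  refine Set.ncard_congr (fun f _ p => ((f p : ℕ) : ℝ)) ?_ ?_ ?_
  · intro f hf
    have hf : Monotone f := by simpa using hf
    refine ⟨fun p q hpq => Nat.cast_le.2 (hf hpq), fun p => ⟨Nat.cast_nonneg _, ?_⟩,
      fun p => ⟨(f p : ℕ), by simp⟩⟩
    exact Nat.cast_le.2 (by omega)
  · intro f g _ _ h
    funext p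
    exact Fin.ext (Nat.cast_injective (congrFun h p))
  · rintro F ⟨hmono, hb, hF⟩
    choose n hn using hF
    have h0 : ∀ p, 0 ≤ n p := fun p => by
      have := (hb p).1
      rw [hn p] at this
      exact_mod_cast this
    have h1 : ∀ p, n p ≤ l := fun p => by
      have := (hb p).2
      rw [hn p] at this
      exact_mod_cast this
    refine ⟨fun p => ⟨(n p).toNat, by have := h0 p; have := h1 p; omega⟩, ?_, ?_⟩
    · simp only [Finset.coe_filter, Finset.mem_univ, true_and, Set.mem_ofPred_eq]
      intro p q hpq
      have := hmono hpq
      rw [hn p, hn q] at this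
      have : n p ≤ n q := by exact_mod_cast this
      exact Fin.mk_le_mk.2 (Int.toNat_le_toNat this)
    · funext p
      rw [hn p]
      have : ((n p).toNat : ℤ) = n p := Int.toNat_of_nonneg (h0 p)
      exact_mod_cast this

end OrderPolynomial

/-! ### Ehrhart polynomials of polygonal chain polytopes -/

section Ehrhart

variable {r s k : ℕ}

theorem chainPolytope_isRationalPolytope (hk1 : 1 ≤ k) (hk : k ≤ s) (hsr : s ≤ r) :
    IsRationalPolytope (chainPolytope r s k) :=
  packingPolytope_isRationalPolytope (𝒞 := {C | IsPolygonal C})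
    (exists_isPolygonal_mem hk1 hk hsr)

theorem ehrhartCount_succ (hk1 : 1 ≤ k) (hk : k < s) (hsr : s ≤ r) (l : ℕ) :
    ehrhartCount (chainPolytope r s (k + 1)) l = ehrhartCount (chainPolytope r s k) l := by
  obtain ⟨L⟩ := LinExt.nonempty (M r s k)
  have hb := zeta_bijOn hk1 hk hsr L 0 (l := (l : ℝ)) (Nat.cast_nonneg l)
  have hlat := zeta_mem_lattice_iff hk1 hk hsr L 0
  unfold ehrhartCount
  rw [← Set.ncard_image_of_injective _ (zeta_injective hk1 hk hsr L 0)]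
  congr 1
  ext y
  constructor
  · rintro ⟨x, ⟨hx, hxl⟩, rfl⟩
    exact ⟨hb.mapsTo hx, (hlat x).1 hxl⟩
  · rintro ⟨hy, hyl⟩
    obtain ⟨x, hx, rfl⟩ := hb.surjOn hy
    exact ⟨x, ⟨hx, (hlat x).2 hyl⟩, rfl⟩

theorem ehrhartCount_eq (hk1 : 1 ≤ k) (hk : k ≤ s) (hsr : s ≤ r) (l : ℕ) :
    ehrhartCount (chainPolytope r s k) l = ehrhartCount (chainPolytope r s 1) l := by
  induction k, hk1 using Nat.le_induction with
  | base => rfl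
  | succ k hk1 ih => rw [ehrhartCount_succ hk1 hk hsr, ih (by omega)]

/-- For k = 1 the point (1, 1) is the minimum of the poset, so every maximal chain contains it. -/
theorem isPolygonal_iff_isMaxChain (hs : 1 ≤ s) (hsr : s ≤ r) (C : Finset (I r s 1)) :
    IsPolygonal C ↔ IsMaxChain (· ≤ ·) (C : Set (I r s 1)) := by
  refine ⟨fun h => h.1, fun h => ⟨h, Or.inr ?_⟩⟩
  have hI : (1, 1) ∈ I r s 1 := mem_I_iff.2 (by unfold InI; omega)
  refine ⟨⟨(1, 1), hI⟩, mem_of_forall_comparable h fun c _ => Or.inr ?_, rfl⟩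
  have := mem_I_iff.1 c.2
  exact Prod.mk_le_mk.2 ⟨this.1, this.2.1⟩

theorem exists_ehrhartPolynomial (hs : 1 ≤ s) (hsr : s ≤ r) :
    ∃ E : Polynomial ℚ, ∀ l : ℕ,
      (ehrhartCount (chainPolytope r s 1) l : ℚ) = E.eval (l : ℚ) := by
  obtain ⟨E, hE⟩ := exists_polynomial_ncard (I r s 1)
  refine ⟨E, fun l => ?_⟩
  rw [← hE l, ehrhartCount, smul_chainPolytope le_rfl hs hsr (Nat.cast_nonneg l)]
  simp only [dilatedPolytope, isPolygonal_iff_isMaxChain hs hsr]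

theorem ehrhartPeriod_eq_one {ι : Type} {Q : Set (ι → ℝ)} {E : Polynomial ℚ}
    (h : ∀ l : ℕ, (ehrhartCount Q l : ℚ) = E.eval (l : ℚ)) : ehrhartPeriod Q = 1 := by
  have h1 : (1 : ℕ) ∈ {n : ℕ | IsEhrhartPeriod Q n} := ⟨one_pos, fun _ => E, h⟩
  exact le_antisymm (Nat.sInf_le h1) (Nat.sInf_mem ⟨1, h1⟩).1

end Ehrhart

end PolygonalChain
end

theorem mainTheorem5 (r s : ℕ) (hs : 1 ≤ s) (hsr : s ≤ r) :
    (∀ (k : ℕ) (_ : 1 ≤ k) (hk : k < s)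
        (L : PolygonalChain.LinExt (PolygonalChain.M r s k)) (a : ℝ),
      Continuous (PolygonalChain.zeta hk L a) ∧
      PolygonalChain.IsPiecewiseLinear (PolygonalChain.zeta hk L a) ∧
      (∀ x : PolygonalChain.I r s (k + 1) → ℝ,
        x ∈ PolygonalChain.lattice (PolygonalChain.I r s (k + 1)) ↔
          PolygonalChain.zeta hk L a x ∈ PolygonalChain.lattice (PolygonalChain.I r s k)) ∧
      ∀ ℓ : ℝ, 0 ≤ ℓ →
        Set.BijOn (PolygonalChain.zeta hk L a)
          (ℓ • PolygonalChain.chainPolytope r s (k + 1))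
          (ℓ • PolygonalChain.chainPolytope r s k)) ∧
    ∃ E : Polynomial ℚ, ∀ k : ℕ, 1 ≤ k → k ≤ s →
      PolygonalChain.IsRationalPolytope (PolygonalChain.chainPolytope r s k) ∧
      (∀ ℓ : ℕ, (PolygonalChain.ehrhartCount (PolygonalChain.chainPolytope r s k) ℓ : ℚ) =
        E.eval (ℓ : ℚ)) ∧
      PolygonalChain.ehrhartPeriod (PolygonalChain.chainPolytope r s k) = 1 ∧
      (¬ PolygonalChain.IsLatticePolytope (PolygonalChain.chainPolytope r s k) →
        PolygonalChain.HasPeriodCollapse (PolygonalChain.chainPolytope r s k)) := by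
  refine ⟨fun k hk1 hk L a => ⟨PolygonalChain.zeta_continuous hk L a,
    PolygonalChain.zeta_isPiecewiseLinear hk L a,
    PolygonalChain.zeta_mem_lattice_iff hk1 hk hsr L a,
    fun ℓ hℓ => PolygonalChain.zeta_bijOn hk1 hk hsr L a hℓ⟩, ?_⟩
  obtain ⟨E, hE⟩ := PolygonalChain.exists_ehrhartPolynomial hs hsr
  refine ⟨E, fun k hk1 hk => ?_⟩
  have hrat := PolygonalChain.chainPolytope_isRationalPolytope hk1 hk hsr
  have hcount : ∀ ℓ : ℕ, (PolygonalChain.ehrhartCount (PolygonalChain.chainPolytope r s k) ℓ : ℚ) =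
      E.eval (ℓ : ℚ) := fun ℓ => by
    rw [PolygonalChain.ehrhartCount_eq hk1 hk hsr, hE]
  have hper := PolygonalChain.ehrhartPeriod_eq_one hcount
  exact ⟨hrat, hcount, hper, fun hl => ⟨hrat, hper ▸ PolygonalChain.one_lt_denominator hrat hl⟩⟩
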